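/- Let $x_1,\dots,x_n$ be $n$ distinct elements of a linearly ordered set, and let bubble sort be applied to a uniformly random permutation $(a_1,\dots,a_n)$ of them (each of the $n!$ arrangements having probability $1/n!$). For $i=1,2,\dots$ the $i$-th pass of bubble sort runs through $j=1,2,\dots,n-i$ in this order, and swaps the entries in positions $j$ and $j+1$ whenever the former is greater than the latter. Let $a^{(i)}$ be the sequence at the end of the $i$-th pass, with $a^{(0)}=(a_1,\dots,a_n)$, and let the number of passes required be $$P_n=\min\{\,i+1 : i\ge 0,\ a^{(i)}_1\le a^{(i)}_2\le\dots\le a^{(i)}_n\,\}.$$ Put $X_n=\dfrac{n-P_n}{\sqrt n}$ and $$\hat E_n=\sqrt{\frac{\pi}{2}}-\frac{5}{3\sqrt n}+\frac{11}{24n}\sqrt{\frac{\pi}{2}}+\frac{4}{135\,n\sqrt n}-\frac{71}{1152\,n^2}\sqrt{\frac{\pi}{2}}.$$ Then, as $n\to\infty$, $$\bigl|\mathbb E(X_n)-\hat E_n\bigr|=\Theta\!\left(\frac{1}{n^2\sqrt n}\right),$$ that is, there are constants $c,C>0$ and $n_0$ such that $\dfrac{c}{n^2\sqrt n}\le\bigl|\mathbb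 E(X_n)-\hat E_n\bigr|\le\dfrac{C}{n^2\sqrt n}$ for all $n\ge n_0$. -/

import Mathlib

open Filter MeasureTheory Asymptotics

namespace BubbleSort

variable {n : ℕ} {α : Type*} [LinearOrder α]

/-- One comparison step of bubble sort on the sequence `a 0, …, a (n - 1)`: the entries at
positions `j` and `j + 1` (counted from `0`) are swapped if they are out of order. -/
def compareSwap (j : ℕ) (a : Fin n → α) : Fin n → α :=
  if h : j + 1 < n then
    if a ⟨j + 1, h⟩ < a ⟨j, Nat.lt_of_succ_lt h⟩ then
      a ∘ Equiv.swap ⟨j, Nat.lt_of_succ_lt h⟩ ⟨j + 1, h⟩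
    else a
  else a

/-- The sequence after the first `m` comparison steps of a pass: positions `(0, 1)`, then
`(1, 2)`, …, then `(m - 1, m)`. -/
def partialPass (a : Fin n → α) : ℕ → Fin n → α
  | 0 => a
  | m + 1 => compareSwap m (partialPass a m)

/-- The sequence at the end of the `i`-th pass of bubble sort; the `i`-th pass
(`i = 1, 2, …`) consists of `n - i` comparison steps. -/
def afterPasses (a : Fin n → α) : ℕ → Fin n → α
  | 0 => a
  | i + 1 => partialPass (afterPasses a i) (n - (i + 1))

/-- The number of passes required to bubble sort `a`, where bubble sort stops at the end of the
first pass in which nothing is left to swap: the least `i + 1` such that the sequence is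
non-decreasing at the end of the `i`-th pass. -/
noncomputable def passes (a : Fin n → α) : ℕ :=
  sInf {p : ℕ | ∃ i : ℕ, p = i + 1 ∧ Monotone (afterPasses a i)}

/-- The normalized number of passes `(n - P) / √n`. -/
noncomputable def normalizedPasses (a : Fin n → α) : ℝ :=
  ((n : ℝ) - (passes a : ℝ)) / √(n : ℝ)

/-- `σ` is a uniformly random permutation of `n` positions under `μ`: it takes each of the `n!`
values with probability `1 / n!`. (In particular `μ` has total mass `1`.) -/
def IsUniformPerm {Ω : Type*} [MeasurableSpace Ω] (μ : Measure Ω)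
    (σ : Ω → Equiv.Perm (Fin n)) : Prop :=
  ∀ τ : Equiv.Perm (Fin n),
    MeasurableSet {ω | σ ω = τ} ∧ μ {ω | σ ω = τ} = ((n.factorial : ℕ) : ENNReal)⁻¹

/-- The asymptotic expansion of the expectation of the normalized number of passes. -/
noncomputable def expansion (n : ℕ) : ℝ :=
  √(Real.pi / 2) - 5 / (3 * √(n : ℝ)) + 11 / (24 * (n : ℝ)) * √(Real.pi / 2)
    + 4 / (135 * (n : ℝ) * √(n : ℝ)) - 71 / (1152 * (n : ℝ) ^ 2) * √(Real.pi / 2)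

end BubbleSort

namespace BubbleSort

/-! Bubble sort acts simply on the inversion table, whose entry at position j (counted from 0) is
the number of larger entries to its left: a pass shifts the table one place and lowers each entry by
one, truncating at 0 (`leftInv_afterPasses`). Hence the number of passes is one plus the largest
table entry. The tables of permutations are exactly the sequences whose j-th entry is at most j
(`image_leftInv`), so for p < n precisely p! p^(n-p) permutations need at most p passes, and E(n -
P) is the sum of `tailProb n k` over k ≥ 1.

This summand behaves like exp(-k²/(2n)). Instead of passing to an integral, it is compared with
C(4n, 2n+k)/C(4n, 2n), which has the same Gaussian profile because Bin(4n, 1/2) has variance n. The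
logarithm of the quotient is expanded with k of weight -1 and 1/n of weight 2; its exponential, cut
after weight 5, is the polynomial `correction`, and the replacement changes the sum by O(n^(-5/2))
(`abs_sum_tailProb_sub_le`).

Polynomials can be summed against binomial weights exactly: modulo telescoping differences they
reduce to constants (`correction_eq`). What remains is a boundary value and a multiple of the
reciprocal central binomial probability. The latter is √(2πn) times a series in 1/n
(`abs_centralRatio_sub_le`) and yields the terms with √(π/2); the boundary values yield the rational
terms. After division by √n the total error is O(n^(-3)), while the first term missing from the
expansion is -8/2835 · n^(-5/2). Its coefficient is nonzero, which gives both bounds. -/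

/-- The number of entries to the left of position `j` that exceed the entry at position `j`
(and `0` when there is no position `j`). -/
def leftInv {n : ℕ} {α : Type*} [LinearOrder α] (a : Fin n → α) (j : ℕ) : ℕ :=
  if h : j < n then (Finset.univ.filter fun i : Fin n => i.val < j ∧ a ⟨j, h⟩ < a i).card else 0

/-! ### Bubble sort passes and the inversion table -/

section Table

variable {n : ℕ} {α : Type*} [LinearOrder α]

lemma leftInv_of_lt (a : Fin n → α) {j : ℕ} (h : j < n) :
    leftInv a j = (Finset.univ.filter fun i : Fin n => i.val < j ∧ a ⟨j, h⟩ < a i).card := by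
  simp [leftInv, h]

lemma leftInv_of_le (a : Fin n → α) {j : ℕ} (h : n ≤ j) : leftInv a j = 0 := by
  simp [leftInv, Nat.not_lt.mpr h]

lemma leftInv_eq_zero_iff (a : Fin n → α) {j : ℕ} (h : j < n) :
    leftInv a j = 0 ↔ ∀ i : Fin n, i.val < j → a i ≤ a ⟨j, h⟩ := by
  simp [leftInv_of_lt a h, Finset.filter_eq_empty_iff]

lemma leftInv_le (a : Fin n → α) (j : ℕ) : leftInv a j ≤ j := by
  by_cases h : j < n
  · rw [leftInv_of_lt a h]
    calc _ ≤ (Finset.univ.filter fun i : Fin n => i.val < j).card :=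
          Finset.card_le_card fun i hi => by simp at hi ⊢; exact hi.1
      _ = j := by
          have := Fin.card_Iio (⟨j, h⟩ : Fin n)
          refine Eq.trans (congrArg Finset.card ?_) this
          ext i
          simp [Fin.lt_def]
  · simp [leftInv_of_le a (not_lt.mp h)]

lemma monotone_iff_leftInv (a : Fin n → α) : Monotone a ↔ ∀ j, leftInv a j = 0 := by
  constructor
  · intro ha j
    by_cases h : j < n
    · exact (leftInv_eq_zero_iff a h).2 fun i hi => ha (Fin.le_def.2 hi.le)
    · exact leftInv_of_le a (not_lt.mp h)
  · intro ha i j hij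
    rcases hij.eq_or_lt with rfl | hij
    · exact le_rfl
    · exact (leftInv_eq_zero_iff a j.2).1 (ha j) i hij

/-- With `leftInv a j = 0` the entry at j is a maximum of the prefix. If it is swapped, the smaller
entry moves left past exactly one larger entry, and the maximum still has nothing larger before it.
If not, both table entries are already 0 and truncated subtraction agrees. -/
lemma leftInv_compareSwap (a : Fin n → α) {j : ℕ} (h : j + 1 < n) (h0 : leftInv a j = 0) (k : ℕ) :
    leftInv (compareSwap j a) k =
      if k = j then leftInv a (j + 1) - 1 else if k = j + 1 then 0 else leftInv a k := by
  have hj : j < n := Nat.lt_of_succ_lt h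
  rw [leftInv_eq_zero_iff a hj] at h0
  by_cases hs : a ⟨j + 1, h⟩ < a ⟨j, hj⟩
  · have hb : compareSwap j a = a ∘ Equiv.swap ⟨j, hj⟩ ⟨j + 1, h⟩ := by simp [compareSwap, h, hs]
    have hne : (⟨j, hj⟩ : Fin n) ≠ ⟨j + 1, h⟩ := by simp
    rw [hb]
    have hoff : ∀ i : Fin n, i.val ≠ j → i.val ≠ j + 1 →
        Equiv.swap (⟨j, hj⟩ : Fin n) ⟨j + 1, h⟩ i = i := fun i h1 h2 =>
      Equiv.swap_apply_of_ne_of_ne (fun e => h1 (by simp [e])) (fun e => h2 (by simp [e]))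
    split_ifs with h1 h2
    · subst h1
      rw [leftInv_of_lt _ hj, leftInv_of_lt a h]
      have : (Finset.univ.filter fun i : Fin n => i.val < k + 1 ∧ a ⟨k + 1, h⟩ < a i)
          = insert ⟨k, hj⟩ (Finset.univ.filter fun i : Fin n => i.val < k ∧
            (a ∘ Equiv.swap ⟨k, hj⟩ ⟨k + 1, h⟩) ⟨k, hj⟩
              < (a ∘ Equiv.swap ⟨k, hj⟩ ⟨k + 1, h⟩) i) := by
        ext i
        by_cases hi : i.val = k
        · have : i = ⟨k, hj⟩ := Fin.ext hi
          subst this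
          simp [hs]
        · have hi' : i ≠ ⟨k, hj⟩ := fun e => hi (by simp [e])
          simp only [Finset.mem_filter, Finset.mem_univ, true_and, Finset.mem_insert, hi',
            false_or, Function.comp_apply, Equiv.swap_apply_left]
          constructor
          · rintro ⟨h1, h2⟩
            have hk : i.val < k := by omega
            exact ⟨hk, by rwa [hoff i hi (by omega)]⟩
          · rintro ⟨h1, h2⟩
            exact ⟨by omega, by rwa [hoff i hi (by omega)] at h2⟩
      rw [this, Finset.card_insert_of_notMem (by simp)]
      simp
    · subst h2
      rw [leftInv_eq_zero_iff _ h]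
      intro i hi
      simp only [Function.comp_apply, Equiv.swap_apply_right]
      by_cases hi' : i.val = j
      · have : i = ⟨j, hj⟩ := Fin.ext hi'
        subst this
        simpa using hs.le
      · rw [hoff i hi' (by omega)]
        exact h0 i (by omega)
    · by_cases hk : k < n
      · rw [leftInv_of_lt _ hk, leftInv_of_lt _ hk]
        refine Finset.card_equiv (Equiv.swap ⟨j, hj⟩ ⟨j + 1, h⟩) fun i => ?_
        simp only [Finset.mem_filter, Finset.mem_univ, true_and, Function.comp_apply,
          hoff ⟨k, hk⟩ h1 h2]
        refine and_congr_left fun _ => ?_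
        by_cases e1 : i = ⟨j, hj⟩
        · subst e1
          simp only [Equiv.swap_apply_left]
          omega
        by_cases e2 : i = ⟨j + 1, h⟩
        · subst e2
          simp only [Equiv.swap_apply_right]
          omega
        rw [Equiv.swap_apply_of_ne_of_ne e1 e2]
      · rw [leftInv_of_le _ (not_lt.mp hk), leftInv_of_le _ (not_lt.mp hk)]
  · have hb : compareSwap j a = a := by simp [compareSwap, h, hs]
    have h1 : leftInv a (j + 1) = 0 := by
      rw [leftInv_eq_zero_iff a h]
      intro i hi
      by_cases hi' : i.val = j
      · have : i = ⟨j, hj⟩ := Fin.ext hi'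
        subst this
        exact not_lt.mp hs
      · exact (h0 i (by omega)).trans (not_lt.mp hs)
    have h2 : leftInv a j = 0 := (leftInv_eq_zero_iff a hj).2 h0
    rw [hb]
    split_ifs with e1 e2
    · simp [e1, h1, h2]
    · simp [e2, h1]
    · rfl

/-- The bubble always carries a prefix maximum, so the table entry at the current position is 0 and
`leftInv_compareSwap` applies at every step. -/
lemma leftInv_partialPass (a : Fin n → α) {m : ℕ} (hm : m < n) (k : ℕ) :
    leftInv (partialPass a m) k =
      if k < m then leftInv a (k + 1) - 1 else if k = m then 0 else leftInv a k := by
  induction m generalizing k with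
  | zero =>
    have : leftInv a 0 = 0 := Nat.le_zero.1 (leftInv_le a 0)
    by_cases hk : k = 0 <;> simp [partialPass, hk, this]
  | succ m ih =>
    have ih := ih (by omega)
    rw [partialPass, leftInv_compareSwap _ hm (by rw [ih]; simp)]
    rw [ih, ih]
    split_ifs <;> first | omega | (subst_vars; rfl)

lemma leftInv_afterPasses (a : Fin n → α) (i k : ℕ) :
    leftInv (afterPasses a i) k = leftInv a (k + i) - i := by
  induction i generalizing k with
  | zero => simp [afterPasses]
  | succ i ih =>
    rw [afterPasses]
    rcases Nat.lt_or_ge (n - (i + 1)) n with h | h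
    · rw [leftInv_partialPass _ h, ih, ih]
      have e : k + (i + 1) = k + 1 + i := by ring
      rw [e]
      split_ifs with h1 h2
      · omega
      -- From the end of the pass onwards the right-hand side reads the table outside the positions,
      -- where its default value is 0; so shortening the passes is harmless.
      · by_cases h3 : n ≤ k + 1 + i
        · rw [leftInv_of_le a h3]; simp
        · omega
      · rw [leftInv_of_le a (by omega), leftInv_of_le a (by omega)]; simp
    · have : n = 0 := by omega
      rw [leftInv_of_le _ (by omega), leftInv_of_le _ (by omega)]; simp

lemma monotone_afterPasses_iff (a : Fin n → α) (i : ℕ) :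
    Monotone (afterPasses a i) ↔ ∀ j, leftInv a j ≤ i := by
  rw [monotone_iff_leftInv]
  simp only [leftInv_afterPasses]
  constructor
  · intro h j
    -- The entries with j < i have been shifted out of sight, but they are at most j anyway.
    rcases Nat.lt_or_ge j i with hj | hj
    · exact (leftInv_le a j).trans hj.le
    · have := h (j - i)
      rw [Nat.sub_add_cancel hj] at this
      omega
  · intro h j
    have := h (j + i)
    omega

lemma passes_le_iff (a : Fin n → α) {p : ℕ} :
    passes a ≤ p ↔ 1 ≤ p ∧ ∀ j, leftInv a j < p := by
  have hmem : ∀ q, q ∈ {p : ℕ | ∃ i : ℕ, p = i + 1 ∧ Monotone (afterPasses a i)} ↔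
      1 ≤ q ∧ ∀ j, leftInv a j < q := by
    intro q
    simp only [Set.mem_ofPred_eq, monotone_afterPasses_iff]
    constructor
    · rintro ⟨i, rfl, h⟩
      exact ⟨by omega, fun j => Nat.lt_succ_of_le (h j)⟩
    · rintro ⟨h1, h2⟩
      exact ⟨q - 1, by omega, fun j => by have := h2 j; omega⟩
  -- Needed because the infimum of an empty set of naturals would be 0.
  have hne : {p : ℕ | ∃ i : ℕ, p = i + 1 ∧ Monotone (afterPasses a i)}.Nonempty := by
    refine ⟨n + 1, (hmem _).2 ⟨by omega, fun j => ?_⟩⟩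
    rcases Nat.lt_or_ge j n with h | h
    · exact (leftInv_le a j).trans_lt (by omega)
    · rw [leftInv_of_le a h]; omega
  rw [passes]
  constructor
  · intro h
    have := (hmem _).1 (Nat.sInf_mem hne)
    exact ⟨this.1.trans h, fun j => (this.2 j).trans_le h⟩
  · intro h
    exact Nat.sInf_le ((hmem p).2 h)

lemma passes_le_card (a : Fin n → α) (hn : 1 ≤ n) : passes a ≤ n := by
  rw [passes_le_iff]
  refine ⟨hn, fun j => ?_⟩
  rcases Nat.lt_or_ge j n with h | h
  · exact (leftInv_le a j).trans_lt h
  · rw [leftInv_of_le a h]; omega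

end Table

/-! ### Counting permutations by their inversion tables -/

section Counting

variable {n : ℕ} {α : Type*} [LinearOrder α]

/-- The values at positions up to j are those not used later, so this entry depends only on `τ j`
and on the later values. This allows reconstruction of `τ` from the right. -/
lemma leftInv_comp_perm (x : Fin n → α) (τ : Equiv.Perm (Fin n))
    (j : Fin n) :
    leftInv (fun k => x (τ k)) j =
      ((Finset.univ.filter fun v => ∀ i, j < i → τ i ≠ v).filter fun v => x (τ j) < x v).card := by
  rw [leftInv_of_lt _ j.2]
  refine Finset.card_equiv τ fun i => ?_
  simp only [Finset.mem_filter, Finset.mem_univ, true_and, ne_eq, EmbeddingLike.apply_eq_iff_eq]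
  refine and_congr_left fun hi => ?_
  constructor
  · intro h i' hi' e
    subst e
    exact absurd (Fin.lt_def.1 hi') (by omega)
  · intro h
    by_contra hc
    rcases eq_or_lt_of_le (not_lt.mp hc : j.val ≤ i.val) with e | e
    · have : i = j := Fin.ext e.symm
      subst this
      exact absurd hi (lt_irrefl _)
    · exact h i (Fin.lt_def.2 e) rfl

/-- At the last position where two permutations differ, the sets of values still available coincide,
and within such a set a value is determined by how many elements exceed it. -/
lemma leftInv_injective {x : Fin n → α} (hx : Function.Injective x) :
    Function.Injective
      fun (τ : Equiv.Perm (Fin n)) (j : Fin n) => leftInv (fun k => x (τ k)) j := by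
  intro τ τ' h
  by_contra hne
  have hex : (Finset.univ.filter fun j => τ j ≠ τ' j).Nonempty := by
    by_contra hc
    rw [Finset.not_nonempty_iff_eq_empty, Finset.filter_eq_empty_iff] at hc
    exact hne (Equiv.ext fun j => not_not.1 (hc (Finset.mem_univ j)))
  obtain ⟨j, hj, hmax⟩ := Finset.exists_max_image _ id hex
  simp only [Finset.mem_filter, Finset.mem_univ, true_and, id] at hj hmax
  have hag : ∀ i, j < i → τ i = τ' i := fun i hi => by
    by_contra hc
    exact absurd (hmax i hc) (not_le.2 hi)
  have hA : (Finset.univ.filter fun v => ∀ i, j < i → τ i ≠ v) =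
      Finset.univ.filter fun v => ∀ i, j < i → τ' i ≠ v := by
    ext v
    simp only [Finset.mem_filter, Finset.mem_univ, true_and]
    exact forall₂_congr fun i hi => by rw [hag i hi]
  have hc := congrFun h j
  simp only [leftInv_comp_perm x] at hc
  rw [← hA] at hc
  set A := Finset.univ.filter fun v => ∀ i, j < i → τ i ≠ v with hAdef
  have m1 : τ j ∈ A := by simp [hAdef]; intro i hi; exact hi.ne'
  have m2 : τ' j ∈ A := by rw [hA]; simp; intro i hi; exact hi.ne'
  have key : ∀ u ∈ A, ∀ v ∈ A, x u < x v →
      (A.filter fun w => x v < x w).card < (A.filter fun w => x u < x w).card := by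
    intro u _ v hv huv
    refine Finset.card_lt_card (Finset.ssubset_iff_subset_ne.2 ⟨?_, ?_⟩)
    · intro w hw
      simp only [Finset.mem_filter] at hw ⊢
      exact ⟨hw.1, huv.trans hw.2⟩
    · intro e
      have : v ∈ A.filter fun w => x v < x w := by
        rw [e]; simp [hv, huv]
      simp at this
  rcases lt_trichotomy (x (τ j)) (x (τ' j)) with h1 | h1 | h1
  · exact absurd hc (key _ m1 _ m2 h1).ne'
  · exact hj (hx h1)
  · exact absurd hc (key _ m2 _ m1 h1).ne

/-- Injectivity suffices, since both sides have n! elements. -/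
lemma image_leftInv {x : Fin n → α} (hx : Function.Injective x) :
    Finset.univ.image (fun (τ : Equiv.Perm (Fin n)) (j : Fin n) => leftInv (fun k => x (τ k)) j) =
      Fintype.piFinset fun j : Fin n => Finset.range (j.val + 1) := by
  refine Finset.eq_of_subset_of_card_le ?_ ?_
  · intro f hf
    obtain ⟨τ, -, rfl⟩ := Finset.mem_image.1 hf
    simp only [Fintype.mem_piFinset, Finset.mem_range]
    exact fun j => Nat.lt_succ_of_le (leftInv_le _ _)
  · rw [Finset.card_image_of_injective _ (leftInv_injective hx), Fintype.card_piFinset]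
    simp only [Finset.card_range, Finset.card_univ, Fintype.card_perm, Fintype.card_fin]
    rw [Fin.prod_univ_eq_prod_range (fun j => j + 1) n, Finset.prod_range_add_one_eq_factorial]

lemma prod_min_eq {p : ℕ} (hp : p ≤ n) :
    ∏ j ∈ Finset.range n, min (j + 1) p = p.factorial * p ^ (n - p) := by
  induction n, hp using Nat.le_induction with
  | base =>
    rw [← Finset.prod_range_add_one_eq_factorial]
    simp only [Nat.sub_self, pow_zero, mul_one]
    exact Finset.prod_congr rfl fun j hj => by have := Finset.mem_range.1 hj; omega
  | succ m hm ih =>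
    rw [Finset.prod_range_succ, ih, Nat.succ_sub hm, pow_succ, min_eq_right (by omega), mul_assoc]

/-- Table entries vary independently, and the bound p leaves min(j + 1, p) choices for the j-th one.
-/
lemma card_passes_le {x : Fin n → α} (hx : Function.Injective x) {p : ℕ} (hp : p < n) :
    (Finset.univ.filter fun τ : Equiv.Perm (Fin n) => passes (fun k => x (τ k)) ≤ p).card =
      p.factorial * p ^ (n - p) := by
  rcases Nat.eq_zero_or_pos p with rfl | hp0
  · have : n ≠ 0 := by omega
    rw [Finset.filter_false_of_mem fun τ _ h => absurd ((passes_le_iff _).1 h).1 (by omega)]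
    simp [this]
  rw [← prod_min_eq hp.le, ← Fin.prod_univ_eq_prod_range (fun j => min (j + 1) p) n,
    ← Finset.card_image_of_injective _ (leftInv_injective hx)]
  have : ∀ j : Fin n, min (j.val + 1) p = (Finset.range (min (j.val + 1) p)).card := by simp
  rw [Finset.prod_congr rfl fun j _ => this j, ← Fintype.card_piFinset]
  congr 1
  ext f
  simp only [Finset.mem_image, Finset.mem_filter, Finset.mem_univ, true_and,
    Fintype.mem_piFinset, Finset.mem_range, lt_min_iff, passes_le_iff]
  constructor
  · rintro ⟨τ, h, rfl⟩ j
    exact ⟨Nat.lt_succ_of_le (leftInv_le _ _), h.2 j⟩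
  · intro h
    have : f ∈ Fintype.piFinset fun j : Fin n => Finset.range (j.val + 1) := by
      simpa using fun j => Nat.le_of_lt_succ (h j).1
    rw [← image_leftInv hx] at this
    obtain ⟨τ, -, rfl⟩ := Finset.mem_image.1 this
    refine ⟨τ, ⟨hp0, fun j => ?_⟩, rfl⟩
    rcases Nat.lt_or_ge j n with hj | hj
    · exact (h ⟨j, hj⟩).2
    · rw [leftInv_of_le _ hj]; exact hp0

/-- Layer-cake summation: n - P counts the p < n with P ≤ p. -/
lemma sum_sub_passes {x : Fin n → α} (hx : Function.Injective x) :
    ∑ τ : Equiv.Perm (Fin n), (n - passes (fun k => x (τ k))) =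
      ∑ p ∈ Finset.range n, p.factorial * p ^ (n - p) := by
  have h1 : ∀ τ : Equiv.Perm (Fin n), n - passes (fun k => x (τ k)) =
      ∑ p ∈ Finset.range n, if passes (fun k => x (τ k)) ≤ p then 1 else 0 := by
    intro τ
    rw [← Finset.card_filter]
    have : (Finset.range n).filter (fun p => passes (fun k => x (τ k)) ≤ p) =
        Finset.Ico (passes fun k => x (τ k)) n := by
      ext p; simp [and_comm]
    rw [this, Nat.card_Ico]
  rw [Finset.sum_congr rfl fun τ _ => h1 τ, Finset.sum_comm]
  refine Finset.sum_congr rfl fun p hp => ?_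
  rw [← card_passes_le hx (Finset.mem_range.1 hp), Finset.card_filter]

end Counting

/-! ### The expectation as a sum of tail probabilities -/

/-- The probability `(n - k)! (n - k) ^ k / n!` that bubble sort needs at most `n - k` passes. -/
noncomputable def tailProb (n k : ℕ) : ℝ :=
  ((n - k).factorial : ℝ) * ((n - k : ℕ) : ℝ) ^ k / (n.factorial : ℝ)

lemma sum_sub_passes_div_factorial {n : ℕ} {α : Type*} [LinearOrder α] {x : Fin n → α}
    (hx : Function.Injective x) (hn : 1 ≤ n) :
    (∑ τ : Equiv.Perm (Fin n), ((n : ℝ) - (passes fun k => x (τ k)))) / n.factorial =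
      ∑ k ∈ Finset.range n, tailProb n (k + 1) := by
  have h1 : ∑ τ : Equiv.Perm (Fin n), ((n : ℝ) - (passes fun k => x (τ k))) =
      ((∑ τ : Equiv.Perm (Fin n), (n - passes (fun k => x (τ k))) : ℕ) : ℝ) := by
    push_cast
    exact Finset.sum_congr rfl fun τ _ => (Nat.cast_sub (passes_le_card _ hn)).symm
  rw [h1, sum_sub_passes hx, ← Finset.sum_range_reflect, Nat.cast_sum, Finset.sum_div]
  refine Finset.sum_congr rfl fun k hk => ?_
  have hk := Finset.mem_range.1 hk
  have e1 : n - 1 - k = n - (k + 1) := by omega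
  have e2 : n - (n - (k + 1)) = k + 1 := by omega
  rw [e1, e2, tailProb]
  push_cast
  rfl

lemma integral_uniformPerm {n : ℕ} {Ω : Type*} [MeasurableSpace Ω] {μ : Measure Ω}
    [IsProbabilityMeasure μ] {σ : Ω → Equiv.Perm (Fin n)} (hσ : IsUniformPerm μ σ)
    (f : Equiv.Perm (Fin n) → ℝ) :
    ∫ ω, f (σ ω) ∂μ = (∑ τ, f τ) / n.factorial := by
  have h1 : ∀ ω, f (σ ω) = ∑ τ, Set.indicator {ω | σ ω = τ} (fun _ => f τ) ω := by
    intro ω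
    simp [Set.indicator_apply]
  simp only [h1]
  rw [integral_finsetSum _ fun τ _ => (integrable_const _).indicator (hσ τ).1, Finset.sum_div]
  refine Finset.sum_congr rfl fun τ _ => ?_
  rw [integral_indicator_const _ (hσ τ).1, Measure.real, (hσ τ).2]
  simp [div_eq_inv_mul]

lemma integral_normalizedPasses {n : ℕ} {α : Type*} [LinearOrder α] {x : Fin n → α}
    (hx : Function.Injective x) (hn : 1 ≤ n) {Ω : Type*} [MeasurableSpace Ω] {μ : Measure Ω}
    [IsProbabilityMeasure μ] {σ : Ω → Equiv.Perm (Fin n)} (hσ : IsUniformPerm μ σ) :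
    ∫ ω, normalizedPasses (fun k : Fin n => x (σ ω k)) ∂μ =
      (∑ k ∈ Finset.range n, tailProb n (k + 1)) / √(n : ℝ) := by
  rw [integral_uniformPerm hσ fun τ => normalizedPasses fun k => x (τ k),
    ← sum_sub_passes_div_factorial hx hn]
  simp only [normalizedPasses]
  rw [← Finset.sum_div, div_right_comm]

/-! ### Truncated exponentials by weighted degree -/

section ExpPoly

/-- The part of weighted degree at most `5` of `exp (l₁ + l₂ + l₃ + l₄ + l₅)`, where `lᵢ` has
weight `i`; the coefficients are computed by the recursion `m aₘ = ∑ j lⱼ aₘ₋ⱼ`. -/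
noncomputable def expCoeff (l₁ l₂ l₃ l₄ l₅ : ℝ) : ℕ → ℝ
  | 0 => 1
  | 1 => l₁
  | 2 => l₁ ^ 2 / 2 + l₂
  | 3 => l₁ ^ 3 / 6 + l₁ * l₂ + l₃
  | 4 => l₁ ^ 4 / 24 + l₁ ^ 2 * l₂ / 2 + l₂ ^ 2 / 2 + l₁ * l₃ + l₄
  | 5 => l₁ ^ 5 / 120 + l₁ ^ 3 * l₂ / 6 + l₁ * l₂ ^ 2 / 2 + l₁ ^ 2 * l₃ / 2 + l₂ * l₃ + l₁ * l₄ + l₅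
  | _ => 0

/-- The truncated exponential with respect to weighted degree. -/
noncomputable def expPoly (l₁ l₂ l₃ l₄ l₅ : ℝ) : ℝ :=
  ∑ i ∈ Finset.range 6, expCoeff l₁ l₂ l₃ l₄ l₅ i

lemma expCoeff_scale (c₁ c₂ c₃ c₄ c₅ u : ℝ) {i : ℕ} (hi : i < 6) :
    expCoeff (c₁ * u) (c₂ * u ^ 2) (c₃ * u ^ 3) (c₄ * u ^ 4) (c₅ * u ^ 5) i =
      expCoeff c₁ c₂ c₃ c₄ c₅ i * u ^ i := by
  interval_cases i <;> simp only [expCoeff] <;> ring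

lemma abs_mul_le_of_le {x y a b : ℝ} (hx : |x| ≤ a) (hy : |y| ≤ b) : |x * y| ≤ a * b := by
  rw [abs_mul]
  exact mul_le_mul hx hy (abs_nonneg _) ((abs_nonneg _).trans hx)

lemma abs_pow_le_one {x : ℝ} (hx : |x| ≤ 1) (n : ℕ) : |x ^ n| ≤ 1 := by
  rw [abs_pow]
  exact pow_le_one₀ (abs_nonneg _) hx

lemma abs_expCoeff_le {c₁ c₂ c₃ c₄ c₅ : ℝ} (h₁ : |c₁| ≤ 1) (h₂ : |c₂| ≤ 1) (h₃ : |c₃| ≤ 1)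
    (h₄ : |c₄| ≤ 1) (h₅ : |c₅| ≤ 1) {i : ℕ} (hi : i < 6) : |expCoeff c₁ c₂ c₃ c₄ c₅ i| ≤ 5 := by
  have p2 := abs_le.1 (abs_pow_le_one h₁ 2)
  have p3 := abs_le.1 (abs_pow_le_one h₁ 3)
  have p4 := abs_le.1 (abs_pow_le_one h₁ 4)
  have p5 := abs_le.1 (abs_pow_le_one h₁ 5)
  have q2 := abs_le.1 (abs_pow_le_one h₂ 2)
  have e1 := abs_le.1 (abs_mul_le_of_le h₁ h₂)
  have e2 := abs_le.1 (abs_mul_le_of_le (abs_pow_le_one h₁ 2) h₂)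
  have e3 := abs_le.1 (abs_mul_le_of_le h₁ h₃)
  have e4 := abs_le.1 (abs_mul_le_of_le (abs_pow_le_one h₁ 3) h₂)
  have e5 := abs_le.1 (abs_mul_le_of_le h₁ (abs_pow_le_one h₂ 2))
  have e6 := abs_le.1 (abs_mul_le_of_le (abs_pow_le_one h₁ 2) h₃)
  have e7 := abs_le.1 (abs_mul_le_of_le h₂ h₃)
  have e8 := abs_le.1 (abs_mul_le_of_le h₁ h₄)
  rw [abs_le] at *
  interval_cases i <;> simp only [expCoeff] <;> constructor <;> linarith

/-- Weighted-degree Taylor expansion of the exponential of a polynomial without constant term. -/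
lemma abs_expCoeff_sum_sub_exp_le {c₁ c₂ c₃ c₄ c₅ u : ℝ} (h₁ : |c₁| ≤ 1) (h₂ : |c₂| ≤ 1)
    (h₃ : |c₃| ≤ 1) (h₄ : |c₄| ≤ 1) (h₅ : |c₅| ≤ 1) (hu : 0 ≤ u) (hu1 : u ≤ 1) :
    |∑ i ∈ Finset.range 6, expCoeff c₁ c₂ c₃ c₄ c₅ i * u ^ i
      - Real.exp (c₁ * u + c₂ * u ^ 2 + c₃ * u ^ 3 + c₄ * u ^ 4 + c₅ * u ^ 5)|
      ≤ 375 * Real.exp 10 * u ^ 6 := by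
  set L : ℝ → ℝ := fun t => c₁ * t + c₂ * t ^ 2 + c₃ * t ^ 3 + c₄ * t ^ 4 + c₅ * t ^ 5 with hL
  set a := expCoeff c₁ c₂ c₃ c₄ c₅ with ha
  have hab : ∀ i < 6, |a i| ≤ 5 := fun i hi => abs_expCoeff_le h₁ h₂ h₃ h₄ h₅ hi
  have hLb : ∀ t ∈ Set.Icc (0 : ℝ) u, |L t| ≤ 5 := by
    intro t ht
    have ht1 : |t| ≤ 1 := by rw [abs_of_nonneg ht.1]; exact ht.2.trans hu1
    have e1 := abs_le.1 (abs_mul_le_of_le h₁ ht1)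
    have e2 := abs_le.1 (abs_mul_le_of_le h₂ (abs_pow_le_one ht1 2))
    have e3 := abs_le.1 (abs_mul_le_of_le h₃ (abs_pow_le_one ht1 3))
    have e4 := abs_le.1 (abs_mul_le_of_le h₄ (abs_pow_le_one ht1 4))
    have e5 := abs_le.1 (abs_mul_le_of_le h₅ (abs_pow_le_one ht1 5))
    rw [abs_le]
    constructor <;> simp only [hL] <;> linarith
  -- With A the truncated sum, the recursion for its coefficients makes L'A - A' vanish below degree
  -- 5, so it equals t⁵Q and F' = -t⁵Q exp(-L). Thus F stays within O(u⁶) of F(0) = 1.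
  set F : ℝ → ℝ := fun t => (∑ i ∈ Finset.range 6, a i * t ^ i) * Real.exp (-L t) with hF
  set Q : ℝ → ℝ := fun t =>
    c₁ * a 5 + 2 * (c₂ * a 4) + 3 * (c₃ * a 3) + 4 * (c₄ * a 2) + 5 * (c₅ * a 1)
    + t * (2 * (c₂ * a 5) + 3 * (c₃ * a 4) + 4 * (c₄ * a 3) + 5 * (c₅ * a 2))
    + t ^ 2 * (3 * (c₃ * a 5) + 4 * (c₄ * a 4) + 5 * (c₅ * a 3))
    + t ^ 3 * (4 * (c₄ * a 5) + 5 * (c₅ * a 4))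
    + t ^ 4 * (5 * (c₅ * a 5)) with hQ
  -- Each of the five coefficients of Q is at most (1+2+3+4+5)·5 = 75 in absolute value.
  have hQb : ∀ t ∈ Set.Icc (0 : ℝ) u, |Q t| ≤ 375 := by
    intro t ht
    have ht1 : |t| ≤ 1 := by rw [abs_of_nonneg ht.1]; exact ht.2.trans hu1
    have m : ∀ {c : ℝ}, |c| ≤ 1 → ∀ i < 6, -5 ≤ c * a i ∧ c * a i ≤ 5 := fun hc i hi => by
      have := abs_le.1 (abs_mul_le_of_le hc (hab i hi)); constructor <;> linarith
    have q0 : |c₁ * a 5 + 2 * (c₂ * a 4) + 3 * (c₃ * a 3) + 4 * (c₄ * a 2) + 5 * (c₅ * a 1)|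
        ≤ 75 := by
      rw [abs_le]
      have := m h₁ 5; have := m h₂ 4; have := m h₃ 3; have := m h₄ 2; have := m h₅ 1
      constructor <;> norm_num at * <;> linarith
    have q1 : |2 * (c₂ * a 5) + 3 * (c₃ * a 4) + 4 * (c₄ * a 3) + 5 * (c₅ * a 2)| ≤ 75 := by
      rw [abs_le]
      have := m h₂ 5; have := m h₃ 4; have := m h₄ 3; have := m h₅ 2
      constructor <;> norm_num at * <;> linarith
    have q2 : |3 * (c₃ * a 5) + 4 * (c₄ * a 4) + 5 * (c₅ * a 3)| ≤ 75 := by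
      rw [abs_le]
      have := m h₃ 5; have := m h₄ 4; have := m h₅ 3
      constructor <;> norm_num at * <;> linarith
    have q3 : |4 * (c₄ * a 5) + 5 * (c₅ * a 4)| ≤ 75 := by
      rw [abs_le]
      have := m h₄ 5; have := m h₅ 4
      constructor <;> norm_num at * <;> linarith
    have q4 : |5 * (c₅ * a 5)| ≤ 75 := by
      rw [abs_le]
      have := m h₅ 5
      constructor <;> norm_num at * <;> linarith
    have r0 := abs_le.1 q0
    have r1 := abs_le.1 (abs_mul_le_of_le ht1 q1)
    have r2 := abs_le.1 (abs_mul_le_of_le (abs_pow_le_one ht1 2) q2)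
    have r3 := abs_le.1 (abs_mul_le_of_le (abs_pow_le_one ht1 3) q3)
    have r4 := abs_le.1 (abs_mul_le_of_le (abs_pow_le_one ht1 4) q4)
    rw [abs_le]
    constructor <;> simp only [hQ] <;> linarith
  have hderiv : ∀ t, HasDerivAt F (-(t ^ 5 * Q t) * Real.exp (-L t)) t := by
    intro t
    have hp : ∀ n : ℕ, HasDerivAt (fun t : ℝ => t ^ n) (n * t ^ (n - 1)) t :=
      fun n => hasDerivAt_pow n t
    have hA : HasDerivAt (fun t : ℝ => ∑ i ∈ Finset.range 6, a i * t ^ i)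
        (∑ i ∈ Finset.range 6, a i * (i * t ^ (i - 1))) t :=
      HasDerivAt.fun_sum fun i _ => (hp i).const_mul _
    have hL' : HasDerivAt L (c₁ * 1 + c₂ * ((2 : ℕ) * t ^ (2 - 1)) + c₃ * ((3 : ℕ) * t ^ (3 - 1))
        + c₄ * ((4 : ℕ) * t ^ (4 - 1)) + c₅ * ((5 : ℕ) * t ^ (5 - 1))) t :=
      (((((hasDerivAt_id t).const_mul c₁).add ((hp 2).const_mul c₂)).add
        ((hp 3).const_mul c₃)).add ((hp 4).const_mul c₄)).add ((hp 5).const_mul c₅)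
    refine (hA.mul hL'.neg.exp).congr_deriv ?_
    simp only [Finset.sum_range_succ, Finset.sum_range_zero, hQ, ha, expCoeff, Pi.neg_apply]
    push_cast
    ring
  have hbound : ∀ t ∈ Set.Icc (0 : ℝ) u,
      ‖-(t ^ 5 * Q t) * Real.exp (-L t)‖ ≤ 375 * u ^ 5 * Real.exp 5 := by
    intro t ht
    rw [Real.norm_eq_abs, abs_mul, abs_neg, abs_mul, Real.abs_exp, abs_pow, abs_of_nonneg ht.1]
    have h1 : t ^ 5 * |Q t| ≤ u ^ 5 * 375 :=
      mul_le_mul (pow_le_pow_left₀ ht.1 ht.2 5) (hQb t ht) (abs_nonneg _) (by positivity)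
    have h2 : Real.exp (-L t) ≤ Real.exp 5 :=
      Real.exp_le_exp.2 (by linarith [(abs_le.1 (hLb t ht)).1])
    calc t ^ 5 * |Q t| * Real.exp (-L t) ≤ u ^ 5 * 375 * Real.exp 5 :=
          mul_le_mul h1 h2 (Real.exp_nonneg _) (by positivity)
      _ = _ := by ring
  have hmvt := (convex_Icc (0 : ℝ) u).norm_image_sub_le_of_norm_hasDerivWithin_le
    (fun t _ => (hderiv t).hasDerivWithinAt) hbound
    (Set.left_mem_Icc.2 hu) (Set.right_mem_Icc.2 hu)
  have hF0 : F 0 = 1 := by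
    simp [hF, hL, ha, Finset.sum_range_succ, expCoeff]
  rw [hF0, Real.norm_eq_abs, Real.norm_eq_abs, sub_zero, abs_of_nonneg hu] at hmvt
  have hfin : ∑ i ∈ Finset.range 6, a i * u ^ i - Real.exp (L u) = (F u - 1) * Real.exp (L u) := by
    simp only [hF]
    rw [sub_mul, mul_assoc, ← Real.exp_add]
    simp
  have h2 : Real.exp (L u) ≤ Real.exp 5 :=
    Real.exp_le_exp.2 (abs_le.1 (hLb u (Set.right_mem_Icc.2 hu))).2
  change |∑ i ∈ Finset.range 6, a i * u ^ i - Real.exp (L u)| ≤ _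
  rw [hfin, abs_mul, Real.abs_exp]
  calc |F u - 1| * Real.exp (L u) ≤ 375 * u ^ 5 * Real.exp 5 * u * Real.exp 5 :=
        mul_le_mul hmvt h2 (Real.exp_nonneg _) (by positivity)
    _ = 375 * (Real.exp 5 * Real.exp 5) * u ^ 6 := by ring
    _ = _ := by rw [← Real.exp_add]; norm_num

lemma abs_div_pow_le_one {l u : ℝ} (hu : 0 < u) {i : ℕ} (h : |l| ≤ u ^ i) : |l / u ^ i| ≤ 1 := by
  rw [abs_div, abs_of_pos (pow_pos hu i)]
  exact div_le_one_of_le₀ h (pow_pos hu i).le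

lemma expPoly_eq_sum {l₁ l₂ l₃ l₄ l₅ u : ℝ} (hu : 0 < u) :
    expPoly l₁ l₂ l₃ l₄ l₅ = ∑ i ∈ Finset.range 6,
      expCoeff (l₁ / u ^ 1) (l₂ / u ^ 2) (l₃ / u ^ 3) (l₄ / u ^ 4) (l₅ / u ^ 5) i * u ^ i := by
  refine Finset.sum_congr rfl fun i hi => ?_
  rw [← expCoeff_scale _ _ _ _ _ _ (Finset.mem_range.1 hi)]
  congr 1 <;> field_simp

lemma abs_expPoly_sub_exp_le {l₁ l₂ l₃ l₄ l₅ u : ℝ} (hu : 0 < u) (hu1 : u ≤ 1)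
    (h₁ : |l₁| ≤ u ^ 1) (h₂ : |l₂| ≤ u ^ 2) (h₃ : |l₃| ≤ u ^ 3) (h₄ : |l₄| ≤ u ^ 4)
    (h₅ : |l₅| ≤ u ^ 5) :
    |expPoly l₁ l₂ l₃ l₄ l₅ - Real.exp (l₁ + l₂ + l₃ + l₄ + l₅)| ≤ 375 * Real.exp 10 * u ^ 6 := by
  have := abs_expCoeff_sum_sub_exp_le (abs_div_pow_le_one hu h₁) (abs_div_pow_le_one hu h₂)
    (abs_div_pow_le_one hu h₃) (abs_div_pow_le_one hu h₄) (abs_div_pow_le_one hu h₅) hu.le hu1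
  rw [← expPoly_eq_sum hu] at this
  convert this using 4
  field_simp

/-- Serves the range where u is not small: nothing is approximated there, and six terms of size at
most 5u⁶ suffice. -/
lemma abs_expPoly_le {l₁ l₂ l₃ l₄ l₅ u : ℝ} (hu : 1 ≤ u)
    (h₁ : |l₁| ≤ u ^ 1) (h₂ : |l₂| ≤ u ^ 2) (h₃ : |l₃| ≤ u ^ 3) (h₄ : |l₄| ≤ u ^ 4)
    (h₅ : |l₅| ≤ u ^ 5) : |expPoly l₁ l₂ l₃ l₄ l₅| ≤ 30 * u ^ 6 := by
  have hu0 : 0 < u := by linarith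
  rw [expPoly_eq_sum hu0]
  refine (Finset.abs_sum_le_sum_abs _ _).trans ?_
  calc _ ≤ ∑ i ∈ Finset.range 6, 5 * u ^ 6 := by
        refine Finset.sum_le_sum fun i hi => ?_
        have hi := Finset.mem_range.1 hi
        refine abs_mul_le_of_le (abs_expCoeff_le (abs_div_pow_le_one hu0 h₁)
          (abs_div_pow_le_one hu0 h₂) (abs_div_pow_le_one hu0 h₃) (abs_div_pow_le_one hu0 h₄)
          (abs_div_pow_le_one hu0 h₅) hi) ?_
        rw [abs_of_pos (pow_pos hu0 i)]
        exact pow_le_pow_right₀ hu hi.le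
    _ = 30 * u ^ 6 := by simp; ring

end ExpPoly

/-! ### Binomial weights, tail probabilities and Gaussian bounds -/

/-- Central binomial weights, normalized to be `1` at `k = 0`. -/
noncomputable def binomWeight (n k : ℕ) : ℝ :=
  ((4 * n).choose (2 * n + k) : ℝ) / ((4 * n).choose (2 * n) : ℝ)

lemma binomWeight_zero (n : ℕ) : binomWeight n 0 = 1 := by
  rw [binomWeight, add_zero, div_self]
  exact_mod_cast (Nat.choose_pos (by omega)).ne'

lemma binomWeight_nonneg (n k : ℕ) : 0 ≤ binomWeight n k := by
  unfold binomWeight; positivity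

lemma binomWeight_eq_zero {n k : ℕ} (h : 2 * n < k) : binomWeight n k = 0 := by
  rw [binomWeight, Nat.choose_eq_zero_of_lt (by omega)]; simp

/-- This first-order recurrence gives both the product formula and, later, the telescoping
summation. -/
lemma binomWeight_succ (n k : ℕ) :
    binomWeight n (k + 1) * (2 * n + k + 1) = binomWeight n k * (2 * n - k) := by
  rcases le_or_gt k (2 * n) with h | h
  · have h1 := Nat.choose_succ_right_eq (4 * n) (2 * n + k)
    have h2 : 4 * n - (2 * n + k) = 2 * n - k := by omega
    rw [h2] at h1
    have h3 : ((4 * n).choose (2 * n + k + 1) : ℝ) * (2 * n + k + 1) =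
        (4 * n).choose (2 * n + k) * (2 * n - k) := by
      have := congrArg (Nat.cast (R := ℝ)) h1
      rw [Nat.cast_mul, Nat.cast_mul, Nat.cast_sub h] at this
      push_cast at this
      linarith
    rw [binomWeight, binomWeight, ← add_assoc, div_mul_eq_mul_div, h3, div_mul_eq_mul_div]
  · rw [binomWeight_eq_zero h, binomWeight_eq_zero (by omega)]; simp

lemma binomWeight_eq_prod (n k : ℕ) :
    binomWeight n k = ∏ j ∈ Finset.range k, ((2 * n - j : ℝ) / (2 * n + j + 1)) := by
  induction k with
  | zero => simp [binomWeight_zero]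
  | succ k ih =>
    have h : (2 * n + k + 1 : ℝ) ≠ 0 := by positivity
    rw [Finset.prod_range_succ, ← ih, ← mul_div_assoc, ← binomWeight_succ, mul_div_cancel_right₀ _ h]

lemma sum_range_two_mul_add_one (k : ℕ) : ∑ j ∈ Finset.range k, (2 * (j : ℝ) + 1) = (k : ℝ) ^ 2 := by
  induction k with
  | zero => simp
  | succ k ih => rw [Finset.sum_range_succ, ih]; push_cast; ring

/-- Each factor is 1 - (2j+1)/(2n+j+1) ≤ exp(-(2j+1)/(4n)), and the odd numbers sum to k². -/
lemma binomWeight_le_exp {n k : ℕ} (hn : 1 ≤ n) :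
    binomWeight n k ≤ Real.exp (-((k : ℝ) ^ 2 / (4 * n))) := by
  rcases lt_or_ge (2 * n) k with h | h
  · rw [binomWeight_eq_zero h]; positivity
  have hn' : (0 : ℝ) < n := by exact_mod_cast hn
  have hk : (k : ℝ) ≤ 2 * n := by exact_mod_cast h
  rw [binomWeight_eq_prod, ← sum_range_two_mul_add_one, Finset.sum_div, ← Finset.sum_neg_distrib,
    Real.exp_sum]
  refine Finset.prod_le_prod (fun j hj => ?_) fun j hj => ?_
  all_goals
    have hj : (j : ℝ) + 1 ≤ k := by exact_mod_cast Finset.mem_range.1 hj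
    have hp : (0 : ℝ) < 2 * n + j + 1 := by positivity
  · exact div_nonneg (by linarith) hp.le
  · have h1 : (2 * n - j : ℝ) / (2 * n + j + 1) = -((2 * j + 1) / (2 * n + j + 1)) + 1 := by
      field_simp; ring
    rw [h1]
    refine (Real.add_one_le_exp _).trans (Real.exp_le_exp.2 (neg_le_neg ?_))
    exact div_le_div_of_nonneg_left (by positivity) hp (by linarith)

lemma tailProb_nonneg (n k : ℕ) : 0 ≤ tailProb n k := by
  unfold tailProb; positivity

lemma tailProb_eq_zero {n k : ℕ} (hk : k ≠ 0) (h : n ≤ k) : tailProb n k = 0 := by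
  simp [tailProb, Nat.sub_eq_zero_of_le h, hk]

lemma tailProb_eq_prod {n k : ℕ} (h : k ≤ n) :
    tailProb n k = ∏ j ∈ Finset.range k, ((n - k : ℝ) / (n - j)) := by
  have h1 := Nat.factorial_mul_descFactorial h
  rw [Nat.descFactorial_eq_prod_range] at h1
  have h2 : ((∏ i ∈ Finset.range k, (n - i) : ℕ) : ℝ) = ∏ j ∈ Finset.range k, (n - j : ℝ) := by
    rw [Nat.cast_prod]
    exact Finset.prod_congr rfl fun j hj =>
      Nat.cast_sub ((Finset.mem_range.1 hj).le.trans h)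
  have h3 : (n.factorial : ℝ) = (n - k).factorial * ∏ j ∈ Finset.range k, (n - j : ℝ) := by
    rw [← h2]; exact_mod_cast h1.symm
  rw [tailProb, h3, Finset.prod_div_distrib, Finset.prod_const, Finset.card_range, Nat.cast_sub h]
  rw [mul_div_mul_left]
  positivity

/-- Each factor is 1 - (k-j)/(n-j) ≤ exp(-(k-j)/n). The resulting exponent k(k+1)/(2n) is weakened
so that the majorant is the one of `binomWeight_le_exp`. -/
lemma tailProb_le_exp {n k : ℕ} (hn : 1 ≤ n) (hk : k ≠ 0) :
    tailProb n k ≤ Real.exp (-((k : ℝ) ^ 2 / (4 * n))) := by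
  rcases lt_or_ge n k with h | h
  · rw [tailProb_eq_zero hk h.le]; positivity
  have hn' : (0 : ℝ) < n := by exact_mod_cast hn
  have hkn : (k : ℝ) ≤ n := by exact_mod_cast h
  have hs : ∑ j ∈ Finset.range k, (((k : ℝ) - j) / n) = k * (k + 1) / (2 * n) := by
    have : ∀ m : ℕ, ∑ j ∈ Finset.range m, ((k : ℝ) - j) = m * k - m * (m - 1) / 2 := by
      intro m
      induction m with
      | zero => simp
      | succ m ih => rw [Finset.sum_range_succ, ih]; push_cast; ring
    rw [← Finset.sum_div, this]
    field_simp
    ring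
  have hk2 : (k : ℝ) ^ 2 / (4 * n) ≤ k * (k + 1) / (2 * n) := by
    rw [div_le_div_iff₀ (by positivity) (by positivity)]
    have : 0 ≤ (k : ℝ) * n := by positivity
    have : 0 ≤ (k : ℝ) ^ 2 * n := by positivity
    nlinarith
  refine le_trans ?_ (Real.exp_le_exp.2 (neg_le_neg hk2))
  rw [← hs, tailProb_eq_prod h, ← Finset.sum_neg_distrib, Real.exp_sum]
  refine Finset.prod_le_prod (fun j hj => ?_) fun j hj => ?_
  all_goals
    have hj : (j : ℝ) + 1 ≤ k := by exact_mod_cast Finset.mem_range.1 hj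
    have hp : (0 : ℝ) < n - j := by linarith
  · exact div_nonneg (by linarith) hp.le
  · have h1 : (n - k : ℝ) / (n - j) = -((k - j) / (n - j)) + 1 := by
      field_simp; ring
    rw [h1]
    refine (Real.add_one_le_exp _).trans (Real.exp_le_exp.2 (neg_le_neg ?_))
    exact div_le_div_of_nonneg_left (by linarith) hp (by simp)

/-! ### Expansion of the logarithm of the quotient -/

/-- The logarithm of `tailProb n k / binomWeight n k` in terms of `y = 1 / n`. -/
noncomputable def logRatio (k : ℕ) (y : ℝ) : ℝ :=
  k * Real.log (1 - k * y) - ∑ j ∈ Finset.range k,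
    (Real.log (1 - j * y) + Real.log (1 - j * y / 2) - Real.log (1 - -((j + 1) * y / 2)))

lemma tailProb_eq_binomWeight_mul_exp {n k : ℕ} (hn : 1 ≤ n) (h : 2 * k ≤ n) :
    tailProb n k = binomWeight n k * Real.exp (logRatio k (1 / n)) := by
  have hn' : (0 : ℝ) < n := by exact_mod_cast hn
  have hkn : 2 * (k : ℝ) ≤ n := by exact_mod_cast h
  have hkn' : (k : ℝ) < n := by linarith
  have h1 : (k : ℝ) * Real.log (1 - k * (1 / n)) =
      ∑ j ∈ Finset.range k, Real.log (1 - k * (1 / n)) := by simp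
  rw [tailProb_eq_prod (by omega), binomWeight_eq_prod, logRatio, h1, ← Finset.sum_sub_distrib,
    Real.exp_sum, ← Finset.prod_mul_distrib]
  refine Finset.prod_congr rfl fun j hj => ?_
  have hj : (j : ℝ) + 1 ≤ k := by exact_mod_cast Finset.mem_range.1 hj
  have hj0 : (0 : ℝ) ≤ j := Nat.cast_nonneg j
  have e1 : 1 - (k : ℝ) * (1 / n) = (n - k) / n := by field_simp
  have e2 : 1 - (j : ℝ) * (1 / n) = (n - j) / n := by field_simp
  have e3 : 1 - (j : ℝ) * (1 / n) / 2 = (2 * n - j) / (2 * n) := by field_simp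
  have e4 : 1 - -(((j : ℝ) + 1) * (1 / n) / 2) = (2 * n + j + 1) / (2 * n) := by field_simp; ring
  have p1 : (0 : ℝ) < n - k := by linarith
  have p2 : (0 : ℝ) < n - j := by linarith
  have p3 : (0 : ℝ) < 2 * n - j := by linarith
  have p4 : (0 : ℝ) < 2 * n + j + 1 := by linarith
  rw [e1, e2, e3, e4, Real.exp_sub, Real.exp_sub, Real.exp_add, Real.exp_log (by positivity),
    Real.exp_log (by positivity), Real.exp_log (by positivity), Real.exp_log (by positivity)]
  field_simp
  exact (div_self (ne_of_gt (by linarith))).symm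

/-- Taylor polynomial of degree `6` of `log (1 - x)`. -/
noncomputable def logPoly (x : ℝ) : ℝ :=
  -(x + x ^ 2 / 2 + x ^ 3 / 3 + x ^ 4 / 4 + x ^ 5 / 5 + x ^ 6 / 6)

lemma abs_log_sub_logPoly_le {x z : ℝ} (h : |x| ≤ z) (hz : z ≤ 1 / 2) :
    |Real.log (1 - x) - logPoly x| ≤ 2 * z ^ 7 := by
  have h1 := Real.abs_log_sub_add_sum_range_le (x := x) (by linarith) 6
  have h2 : ∑ i ∈ Finset.range 6, x ^ (i + 1) / ((i : ℝ) + 1) + Real.log (1 - x) =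
      Real.log (1 - x) - logPoly x := by
    simp only [Finset.sum_range_succ, Finset.sum_range_zero, logPoly]
    push_cast
    ring
  rw [h2] at h1
  refine h1.trans ?_
  rw [div_le_iff₀ (by linarith)]
  have h3 : |x| ^ 7 ≤ z ^ 7 := pow_le_pow_left₀ (abs_nonneg _) h 7
  have h4 : 0 ≤ z ^ 7 := by have := (abs_nonneg x).trans h; positivity
  have h5 : 2 * z ^ 7 * (1 / 2) ≤ 2 * z ^ 7 * (1 - |x|) :=
    mul_le_mul_of_nonneg_left (by linarith) (by linarith)
  norm_num at h3 ⊢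
  linarith

/-- The part of weight `1` of the expansion of `logRatio`, where `k` has weight `-1` and `y`
has weight `2`. -/
noncomputable def logTerm₁ (k y : ℝ) : ℝ := -(k * y) / 2 - k ^ 3 * y ^ 2 / 3
/-- The part of weight `2` of the expansion of `logRatio`. -/
noncomputable def logTerm₂ (k y : ℝ) : ℝ := -3 / 8 * k ^ 2 * y ^ 2 - 11 / 48 * k ^ 4 * y ^ 3
/-- The part of weight `3` of the expansion of `logRatio`. -/
noncomputable def logTerm₃ (k y : ℝ) : ℝ :=
  k * y ^ 2 / 12 - k ^ 3 * y ^ 3 / 6 - k ^ 5 * y ^ 4 / 5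
/-- The part of weight `4` of the expansion of `logRatio`. -/
noncomputable def logTerm₄ (k y : ℝ) : ℝ :=
  5 / 48 * k ^ 2 * y ^ 3 - 9 / 64 * k ^ 4 * y ^ 4 - 79 / 480 * k ^ 6 * y ^ 5
/-- The part of weight `5` of the expansion of `logRatio`. -/
noncomputable def logTerm₅ (k y : ℝ) : ℝ :=
  k ^ 3 * y ^ 4 / 12 - k ^ 5 * y ^ 5 / 10 - k ^ 7 * y ^ 6 / 7
/-- The terms of weight at least `6` that come from the Taylor polynomials of the logarithms. -/
noncomputable def logRest (k y : ℝ) : ℝ :=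
  17 / 192 * k ^ 4 * y ^ 5 - 11 / 128 * k ^ 6 * y ^ 6 - k * y ^ 4 / 120 + k ^ 5 * y ^ 6 / 12
    - 17 / 960 * k ^ 2 * y ^ 5 - k ^ 3 * y ^ 6 / 36 + k * y ^ 6 / 252

/-- The expansion of `logRatio` up to weight `5`. -/
noncomputable def logMain (k y : ℝ) : ℝ :=
  logTerm₁ k y + logTerm₂ k y + logTerm₃ k y + logTerm₄ k y + logTerm₅ k y

/-- Power sums over j are polynomials in k, so the closed form follows by comparing increments. -/
lemma sum_logPoly (k : ℕ) (y : ℝ) :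
    k * logPoly (k * y) - ∑ j ∈ Finset.range k,
      (logPoly (j * y) + logPoly (j * y / 2) - logPoly (-((j + 1) * y / 2))) =
      logMain k y + logRest k y := by
  have h : ∑ j ∈ Finset.range k,
      (logPoly (j * y) + logPoly (j * y / 2) - logPoly (-((j + 1) * y / 2))) =
      k * logPoly (k * y) - (logMain k y + logRest k y) := by
    induction k with
    | zero => simp [logMain, logRest, logTerm₁, logTerm₂, logTerm₃, logTerm₄, logTerm₅]
    | succ k ih =>
      rw [Finset.sum_range_succ, ih]
      simp only [logMain, logRest, logTerm₁, logTerm₂, logTerm₃, logTerm₄, logTerm₅, logPoly]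
      push_cast
      ring
  rw [h]; ring

/-- Every argument is at most ky in absolute value. The constant is 8 = 2 + 3·2: one logarithm
outside the sum and three in each summand. -/
lemma abs_logRatio_sub_le {k : ℕ} {y : ℝ} (hk : 1 ≤ k) (hy : 0 ≤ y) (hky : k * y ≤ 1 / 2) :
    |logRatio k y - (logMain k y + logRest k y)| ≤ 8 * k * (k * y) ^ 7 := by
  have hk' : (1 : ℝ) ≤ k := by exact_mod_cast hk
  rw [← sum_logPoly, logRatio, sub_sub_sub_comm, ← mul_sub, ← Finset.sum_sub_distrib]
  have h0 : |(k : ℝ) * (Real.log (1 - k * y) - logPoly (k * y))| ≤ k * (2 * (k * y) ^ 7) := by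
    rw [abs_mul, Nat.abs_cast]
    refine mul_le_mul_of_nonneg_left (abs_log_sub_logPoly_le (abs_of_nonneg ?_).le hky) (by linarith)
    positivity
  have h1 : |∑ j ∈ Finset.range k, (Real.log (1 - j * y) + Real.log (1 - j * y / 2)
      - Real.log (1 - -((j + 1) * y / 2)) -
      (logPoly (j * y) + logPoly (j * y / 2) - logPoly (-((j + 1) * y / 2))))| ≤
      k * (6 * (k * y) ^ 7) := by
    refine (Finset.abs_sum_le_sum_abs _ _).trans ?_
    refine (Finset.sum_le_card_nsmul _ _ (6 * (k * y) ^ 7) fun j hj => ?_).trans (by simp)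
    have hj : (j : ℝ) + 1 ≤ k := by exact_mod_cast Finset.mem_range.1 hj
    have hj0 : (0 : ℝ) ≤ j := Nat.cast_nonneg j
    have hjy : ((j : ℝ) + 1) * y ≤ k * y := mul_le_mul_of_nonneg_right hj hy
    have hjy0 : (0 : ℝ) ≤ j * y := mul_nonneg hj0 hy
    have b1 := abs_le.1 (abs_log_sub_logPoly_le (x := j * y) (z := k * y)
      (by rw [abs_of_nonneg hjy0]; linarith) hky)
    have b2 := abs_le.1 (abs_log_sub_logPoly_le (x := j * y / 2) (z := k * y)
      (by rw [abs_of_nonneg (by linarith)]; linarith) hky)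
    have b3 := abs_le.1 (abs_log_sub_logPoly_le (x := -((j + 1) * y / 2)) (z := k * y)
      (by rw [abs_neg, abs_of_nonneg (by linarith)]; linarith) hky)
    rw [abs_le]
    constructor <;> linarith
  refine (abs_sub _ _).trans ((add_le_add h0 h1).trans (le_of_eq (by ring)))

lemma pow_le_one_add_pow {s : ℝ} (hs : 0 ≤ s) {a N : ℕ} (h : a ≤ N) : s ^ a ≤ (1 + s) ^ N :=
  (pow_le_pow_left₀ hs (by linarith) a).trans (pow_le_pow_right₀ (by linarith) h)

/-- With s = kh, the part of weight i is hⁱ times a polynomial in s of degree i + 2 ≤ 3i with small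
coefficients. The common shape (h(1+s)³)ⁱ is what the bounds on `expPoly` require. -/
lemma abs_logTerm_le {k h : ℝ} (hk : 0 ≤ k) (hh : 0 ≤ h) :
    |logTerm₁ k (h ^ 2)| ≤ (h * (1 + k * h) ^ 3) ^ 1 ∧
    |logTerm₂ k (h ^ 2)| ≤ (h * (1 + k * h) ^ 3) ^ 2 ∧
    |logTerm₃ k (h ^ 2)| ≤ (h * (1 + k * h) ^ 3) ^ 3 ∧
    |logTerm₄ k (h ^ 2)| ≤ (h * (1 + k * h) ^ 3) ^ 4 ∧
    |logTerm₅ k (h ^ 2)| ≤ (h * (1 + k * h) ^ 3) ^ 5 := by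
  have hs : 0 ≤ k * h := mul_nonneg hk hh
  have key : ∀ (i N : ℕ), N = 3 * i → ∀ (p x : ℝ), x = h ^ i * p → |p| ≤ (1 + k * h) ^ N →
      |x| ≤ (h * (1 + k * h) ^ 3) ^ i := by
    intro i N hN p x hx hp
    subst hN
    rw [hx, abs_mul, abs_of_nonneg (pow_nonneg hh i), mul_pow, ← pow_mul]
    exact mul_le_mul_of_nonneg_left hp (pow_nonneg hh i)
  have m : ∀ a N : ℕ, a ≤ N → 0 ≤ (k * h) ^ a ∧ (k * h) ^ a ≤ (1 + k * h) ^ N := fun a N hN =>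
    ⟨pow_nonneg hs a, pow_le_one_add_pow hs hN⟩
  refine ⟨key 1 3 rfl (-(k * h) ^ 1 / 2 - (k * h) ^ 3 / 3) _ (by unfold logTerm₁; ring) ?_,
    key 2 6 rfl (-3 / 8 * (k * h) ^ 2 - 11 / 48 * (k * h) ^ 4) _ (by unfold logTerm₂; ring) ?_,
    key 3 9 rfl ((k * h) ^ 1 / 12 - (k * h) ^ 3 / 6 - (k * h) ^ 5 / 5) _ (by unfold logTerm₃; ring) ?_,
    key 4 12 rfl (5 / 48 * (k * h) ^ 2 - 9 / 64 * (k * h) ^ 4 - 79 / 480 * (k * h) ^ 6) _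
      (by unfold logTerm₄; ring) ?_,
    key 5 15 rfl ((k * h) ^ 3 / 12 - (k * h) ^ 5 / 10 - (k * h) ^ 7 / 7) _ (by unfold logTerm₅; ring) ?_⟩
  · obtain ⟨_, _⟩ := m 1 3 (by norm_num); obtain ⟨_, _⟩ := m 3 3 (by norm_num)
    rw [abs_le]; constructor <;> linarith
  · obtain ⟨_, _⟩ := m 2 6 (by norm_num); obtain ⟨_, _⟩ := m 4 6 (by norm_num)
    rw [abs_le]; constructor <;> linarith
  · obtain ⟨_, _⟩ := m 1 9 (by norm_num); obtain ⟨_, _⟩ := m 3 9 (by norm_num)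
    obtain ⟨_, _⟩ := m 5 9 (by norm_num)
    rw [abs_le]; constructor <;> linarith
  · obtain ⟨_, _⟩ := m 2 12 (by norm_num); obtain ⟨_, _⟩ := m 4 12 (by norm_num)
    obtain ⟨_, _⟩ := m 6 12 (by norm_num)
    rw [abs_le]; constructor <;> linarith
  · obtain ⟨_, _⟩ := m 3 15 (by norm_num); obtain ⟨_, _⟩ := m 5 15 (by norm_num)
    obtain ⟨_, _⟩ := m 7 15 (by norm_num)
    rw [abs_le]; constructor <;> linarith

lemma abs_logRest_le {k h : ℝ} (hk : 0 ≤ k) (hh : 0 ≤ h) (hh1 : h ≤ 1) :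
    |logRest k (h ^ 2)| ≤ h ^ 6 * (1 + k * h) ^ 8 := by
  have hs : 0 ≤ k * h := mul_nonneg hk hh
  have m : ∀ i a : ℕ, a ≤ 8 →
      0 ≤ h ^ i * (k * h) ^ a ∧ h ^ i * (k * h) ^ a ≤ (1 + k * h) ^ 8 := fun i a ha =>
    ⟨by positivity, (mul_le_of_le_one_left (by positivity) (pow_le_one₀ hh hh1)).trans
      (pow_le_one_add_pow hs ha)⟩
  have e : logRest k (h ^ 2) = h ^ 6 * (17 / 192 * (h ^ 0 * (k * h) ^ 4)
      - 11 / 128 * (h ^ 0 * (k * h) ^ 6) - (h ^ 1 * (k * h) ^ 1) / 120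
      + (h ^ 1 * (k * h) ^ 5) / 12 - 17 / 960 * (h ^ 2 * (k * h) ^ 2)
      - (h ^ 3 * (k * h) ^ 3) / 36 + (h ^ 5 * (k * h) ^ 1) / 252) := by
    unfold logRest; ring
  rw [e, abs_mul, abs_of_nonneg (pow_nonneg hh 6)]
  refine mul_le_mul_of_nonneg_left ?_ (pow_nonneg hh 6)
  obtain ⟨_, _⟩ := m 0 4 (by norm_num); obtain ⟨_, _⟩ := m 0 6 (by norm_num); obtain ⟨_, _⟩ := m 1 1 (by norm_num)
  obtain ⟨_, _⟩ := m 1 5 (by norm_num); obtain ⟨_, _⟩ := m 2 2 (by norm_num); obtain ⟨_, _⟩ := m 3 3 (by norm_num)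
  obtain ⟨_, _⟩ := m 5 1 (by norm_num)
  rw [abs_le]; constructor <;> linarith

/-! ### Replacing tail probabilities by corrected binomial weights -/

/-- The correction factor relating `tailProb n k` to `binomWeight n k`, with `y = 1 / n`. -/
noncomputable def correction (k y : ℝ) : ℝ :=
  expPoly (logTerm₁ k y) (logTerm₂ k y) (logTerm₃ k y) (logTerm₄ k y) (logTerm₅ k y)

lemma abs_exp_sub_correction_le : ∃ C : ℝ, 0 ≤ C ∧ ∀ (k : ℕ) (h : ℝ), 1 ≤ k → 0 < h → h ≤ 1 →
    2 * (h * (1 + k * h) ^ 3) ≤ 1 →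
    |Real.exp (logRatio k (h ^ 2)) - correction k (h ^ 2)| ≤ C * (2 * (h * (1 + k * h) ^ 3)) ^ 6 := by
  -- The first summand comes from truncating the exponential. The second comes from the logarithm:
  -- its error is at most (8 + 1)v⁶ ≤ 9, and 14 = 5 + 9 adds the bound 5 on `logMain`.
  refine ⟨375 * Real.exp 10 + 9 * Real.exp 14, by positivity, ?_⟩
  intro k h hk hh hh1 hu1
  set s := (k : ℝ) * h with hs
  have hs0 : 0 ≤ s := by positivity
  set v := h * (1 + s) ^ 3 with hv
  have hv0 : 0 < v := by positivity
  have hk0 : (0 : ℝ) ≤ k := Nat.cast_nonneg k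
  obtain ⟨b1, b2, b3, b4, b5⟩ := abs_logTerm_le hk0 hh.le
  rw [← hs, ← hv] at b1 b2 b3 b4 b5
  have hpow : ∀ i : ℕ, v ^ i ≤ (2 * v) ^ i := fun i => pow_le_pow_left₀ hv0.le (by linarith) i
  have hE := abs_expPoly_sub_exp_le (by linarith) hu1 (b1.trans (hpow 1)) (b2.trans (hpow 2))
    (b3.trans (hpow 3)) (b4.trans (hpow 4)) (b5.trans (hpow 5))
  have hM : |logMain k (h ^ 2)| ≤ 5 := by
    have hv1 : ∀ i : ℕ, v ^ i ≤ 1 := fun i => pow_le_one₀ hv0.le (by linarith)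
    have a1 := abs_le.1 (b1.trans (hv1 1))
    have a2 := abs_le.1 (b2.trans (hv1 2))
    have a3 := abs_le.1 (b3.trans (hv1 3))
    have a4 := abs_le.1 (b4.trans (hv1 4))
    have a5 := abs_le.1 (b5.trans (hv1 5))
    rw [abs_le]
    constructor <;> unfold logMain <;> linarith
  have h8 : h ^ 6 * (1 + s) ^ 8 ≤ v ^ 6 := by
    rw [hv, mul_pow, ← pow_mul]
    exact mul_le_mul_of_nonneg_left (pow_le_pow_right₀ (by linarith) (by norm_num)) (by positivity)
  have hky : (k : ℝ) * h ^ 2 ≤ 1 / 2 := by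
    have h1 : (k : ℝ) * h ^ 2 = h * s ^ 1 := by rw [hs]; ring
    have h2 : h * s ^ 1 ≤ v :=
      mul_le_mul_of_nonneg_left (pow_le_one_add_pow hs0 (by norm_num)) hh.le
    linarith
  have hR := abs_logRatio_sub_le hk (sq_nonneg h) hky
  have hR' : 8 * (k : ℝ) * (k * h ^ 2) ^ 7 ≤ 8 * v ^ 6 := by
    have h1 : 8 * (k : ℝ) * (k * h ^ 2) ^ 7 = 8 * (h ^ 6 * s ^ 8) := by rw [hs]; ring
    have h2 : h ^ 6 * s ^ 8 ≤ h ^ 6 * (1 + s) ^ 8 :=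
      mul_le_mul_of_nonneg_left (pow_le_one_add_pow hs0 le_rfl) (by positivity)
    linarith
  have hRest := abs_logRest_le hk0 hh.le hh1
  rw [← hs] at hRest
  have hd : |logRatio k (h ^ 2) - logMain k (h ^ 2)| ≤ 9 * v ^ 6 := by
    have r1 := abs_le.1 (hR.trans hR')
    have r2 := abs_le.1 (hRest.trans h8)
    rw [abs_le]
    constructor <;> linarith
  set d := logRatio k (h ^ 2) - logMain k (h ^ 2) with hdd
  have hd9 : |d| ≤ 9 := by
    have : v ^ 6 ≤ 1 := pow_le_one₀ hv0.le (by linarith)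
    linarith
  have hexp : |Real.exp (logRatio k (h ^ 2)) - Real.exp (logMain k (h ^ 2))| ≤
      9 * Real.exp 14 * v ^ 6 := by
    have e : Real.exp (logRatio k (h ^ 2)) - Real.exp (logMain k (h ^ 2)) =
        Real.exp (logMain k (h ^ 2)) * (Real.exp d - 1) := by
      rw [mul_sub, ← Real.exp_add, hdd]; ring_nf
    have e1 : |Real.exp d - 1| ≤ |d| * Real.exp 9 := by
      have l1 := Real.add_one_le_exp d
      have l2 := Real.add_one_le_exp (-d)
      have l3 : Real.exp d * Real.exp (-d) = 1 := by rw [← Real.exp_add]; simp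
      have l4 : Real.exp d ≤ Real.exp 9 := Real.exp_le_exp.2 ((le_abs_self d).trans hd9)
      have l5 : Real.exp d - 1 ≤ d * Real.exp d := by
        have := mul_le_mul_of_nonneg_left l2 (Real.exp_nonneg d)
        linarith
      have l6 : d * Real.exp d ≤ |d| * Real.exp 9 :=
        mul_le_mul (le_abs_self d) l4 (Real.exp_nonneg _) (abs_nonneg _)
      have l7 : |d| ≤ |d| * Real.exp 9 :=
        le_mul_of_one_le_right (abs_nonneg _) (Real.one_le_exp (by norm_num))
      rw [abs_le]
      exact ⟨by linarith [neg_abs_le d], by linarith⟩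
    rw [e]
    have e2 : |Real.exp (logMain k (h ^ 2))| ≤ Real.exp 5 := by
      rw [Real.abs_exp]
      exact Real.exp_le_exp.2 (abs_le.1 hM).2
    refine (abs_mul_le_of_le e2 (e1.trans
      (mul_le_mul_of_nonneg_right hd (Real.exp_nonneg _)))).trans (le_of_eq ?_)
    have : Real.exp 14 = Real.exp 5 * Real.exp 9 := by rw [← Real.exp_add]; norm_num
    rw [this]; ring
  have hE' : |correction k (h ^ 2) - Real.exp (logMain k (h ^ 2))| ≤
      375 * Real.exp 10 * (2 * v) ^ 6 := hE
  have f1 := abs_le.1 (hexp.trans (mul_le_mul_of_nonneg_left (hpow 6) (by positivity)))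
  have f2 := abs_le.1 hE'
  rw [abs_le, add_mul]
  constructor <;> linarith

lemma abs_correction_le {k h : ℝ} (hk : 0 ≤ k) (hh : 0 ≤ h)
    (hu : 1 ≤ 2 * (h * (1 + k * h) ^ 3)) :
    |correction k (h ^ 2)| ≤ 30 * (2 * (h * (1 + k * h) ^ 3)) ^ 6 := by
  obtain ⟨b1, b2, b3, b4, b5⟩ := abs_logTerm_le hk hh
  have hpow : ∀ i : ℕ, (h * (1 + k * h) ^ 3) ^ i ≤ (2 * (h * (1 + k * h) ^ 3)) ^ i := fun i =>
    pow_le_pow_left₀ (by linarith) (by linarith) i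
  exact abs_expPoly_le hu (b1.trans (hpow 1)) (b2.trans (hpow 2)) (b3.trans (hpow 3))
    (b4.trans (hpow 4)) (b5.trans (hpow 5))

/-- The exponent is 20 = 18 + 2: the error u⁶ contains (1+s)¹⁸, and two further powers leave the
summable factor (1+s)⁻². -/
lemma one_add_pow_mul_exp_le : ∃ C : ℝ, 0 ≤ C ∧ ∀ s : ℝ, 0 ≤ s →
    (1 + s) ^ 20 * Real.exp (-(s ^ 2 / 4)) ≤ C := by
  refine ⟨8 ^ 10 * (Nat.factorial 10 * Real.exp 1), by positivity, fun s hs => ?_⟩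
  have h1 : (1 + s) ^ 20 ≤ 8 ^ 10 * (1 + s ^ 2 / 4) ^ 10 := by
    have : (1 + s) ^ 2 ≤ 8 * (1 + s ^ 2 / 4) := by nlinarith [sq_nonneg (s - 1)]
    calc (1 + s) ^ 20 = ((1 + s) ^ 2) ^ 10 := by ring
      _ ≤ (8 * (1 + s ^ 2 / 4)) ^ 10 := pow_le_pow_left₀ (by positivity) this 10
      _ = _ := by rw [mul_pow]
  have h2 : (1 + s ^ 2 / 4) ^ 10 ≤ Nat.factorial 10 * Real.exp (1 + s ^ 2 / 4) := by
    have := Real.pow_div_factorial_le_exp (1 + s ^ 2 / 4) (by positivity) 10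
    rw [div_le_iff₀ (by positivity)] at this
    linarith
  calc (1 + s) ^ 20 * Real.exp (-(s ^ 2 / 4))
      ≤ 8 ^ 10 * (Nat.factorial 10 * Real.exp (1 + s ^ 2 / 4)) * Real.exp (-(s ^ 2 / 4)) :=
        mul_le_mul_of_nonneg_right (h1.trans (mul_le_mul_of_nonneg_left h2 (by positivity)))
          (Real.exp_nonneg _)
    _ = 8 ^ 10 * (Nat.factorial 10 * (Real.exp (1 + s ^ 2 / 4) * Real.exp (-(s ^ 2 / 4)))) := by
        ring
    _ = _ := by rw [← Real.exp_add]; congr 4; ring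

lemma abs_tailProb_sub_le : ∃ C : ℝ, 0 ≤ C ∧ ∀ n k : ℕ, 1 ≤ n → 1 ≤ k →
    |tailProb n k - binomWeight n k * correction k (1 / n)| ≤
      C * ((1 / √n) ^ 6 / (1 + k * (1 / √n)) ^ 2) := by
  obtain ⟨C₁, hC₁, h₁⟩ := abs_exp_sub_correction_le
  obtain ⟨C₂, hC₂, h₂⟩ := one_add_pow_mul_exp_le
  refine ⟨(C₁ + 31) * 64 * C₂, by positivity, fun n k hn hk => ?_⟩
  have hn' : (1 : ℝ) ≤ n := by exact_mod_cast hn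
  have hr : 1 ≤ √(n : ℝ) := Real.one_le_sqrt.2 hn'
  set h := 1 / √(n : ℝ) with hh
  have hh0 : 0 < h := by positivity
  have hh1 : h ≤ 1 := by rw [hh, div_le_one (by linarith)]; exact hr
  have hy : (1 : ℝ) / n = h ^ 2 := by
    rw [hh, div_pow, Real.sq_sqrt (by linarith), one_pow]
  have hk0 : (0 : ℝ) ≤ k := Nat.cast_nonneg k
  set s := (k : ℝ) * h with hs
  have hs0 : 0 ≤ s := by positivity
  have hs2 : (k : ℝ) ^ 2 / (4 * n) = s ^ 2 / 4 := by
    rw [hs, mul_pow, ← hy]; field_simp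
  have hb := binomWeight_le_exp (k := k) hn
  have hT := tailProb_le_exp hn (k := k) (by omega)
  have hb0 := binomWeight_nonneg n k
  have hT0 := tailProb_nonneg n k
  rw [hs2] at hb hT
  set E := Real.exp (-(s ^ 2 / 4)) with hE
  have hE0 : 0 ≤ E := Real.exp_nonneg _
  set u := 2 * (h * (1 + s) ^ 3) with hu
  have hu0 : 0 ≤ u := by positivity
  have main : |tailProb n k - binomWeight n k * correction k (h ^ 2)| ≤ (C₁ + 31) * (u ^ 6 * E) := by
    -- For u ≤ 1 the expansion is valid. For u > 1 the Gaussian majorant bounds both terms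
    -- separately, at the cost 30 + 1, because u⁶ ≥ 1.
    rcases le_or_gt u 1 with h1 | h1
    · have hkn : 2 * k ≤ n := by
        have e1 : h * s ^ 1 ≤ h * (1 + s) ^ 3 :=
          mul_le_mul_of_nonneg_left (pow_le_one_add_pow hs0 (by norm_num)) hh0.le
        have e2 : h * s ^ 1 = k * (1 / n) := by rw [hs, hy]; ring
        have e3 : 2 * ((k : ℝ) * (1 / n)) ≤ 1 := by rw [← e2]; linarith
        have e4 : 2 * (k : ℝ) ≤ n := by
          have := mul_le_mul_of_nonneg_right e3 (by linarith : (0 : ℝ) ≤ n)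
          field_simp at this
          linarith
        exact_mod_cast e4
      rw [tailProb_eq_binomWeight_mul_exp hn hkn, hy, ← mul_sub, abs_mul, abs_of_nonneg hb0]
      have := h₁ k h hk hh0 hh1 h1
      calc binomWeight n k * |Real.exp (logRatio k (h ^ 2)) - correction k (h ^ 2)|
          ≤ E * (C₁ * u ^ 6) := mul_le_mul hb this (abs_nonneg _) hE0
        _ ≤ (C₁ + 31) * (u ^ 6 * E) := by
          have : 0 ≤ u ^ 6 * E := by positivity
          nlinarith
    · have hc := abs_correction_le hk0 hh0.le h1.le
      have hu6 : 1 ≤ u ^ 6 := one_le_pow₀ h1.le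
      refine (abs_sub _ _).trans ?_
      rw [abs_mul, abs_of_nonneg hb0, abs_of_nonneg hT0]
      have t1 : binomWeight n k * |correction k (h ^ 2)| ≤ E * (30 * u ^ 6) :=
        mul_le_mul hb hc (abs_nonneg _) hE0
      have t2 : E ≤ E * u ^ 6 := le_mul_of_one_le_right hE0 hu6
      have t3 : 0 ≤ C₁ * (u ^ 6 * E) := by positivity
      linarith
  rw [hy]
  refine main.trans ?_
  have hp : (0 : ℝ) < (1 + s) ^ 2 := by positivity
  rw [← mul_div_assoc, le_div_iff₀ hp]
  have e := h₂ s hs0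
  calc (C₁ + 31) * (u ^ 6 * E) * (1 + s) ^ 2
      = (C₁ + 31) * 64 * h ^ 6 * ((1 + s) ^ 20 * E) := by rw [hu]; ring
    _ ≤ (C₁ + 31) * 64 * h ^ 6 * C₂ := mul_le_mul_of_nonneg_left e (by positivity)
    _ = _ := by ring

/-- The terms are dominated by telescoping differences of 1/(1+kh); like a Riemann sum, the
summation costs one factor h. -/
lemma sum_one_div_sq_le {h : ℝ} (hh : 0 < h) (m : ℕ) :
    ∑ k ∈ Finset.range m, h ^ 6 / (1 + ((k + 1 : ℕ) : ℝ) * h) ^ 2 ≤ h ^ 5 := by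
  have key : ∑ k ∈ Finset.range m, h ^ 6 / (1 + ((k + 1 : ℕ) : ℝ) * h) ^ 2 ≤
      h ^ 5 * (1 - 1 / (1 + m * h)) := by
    induction m with
    | zero => simp
    | succ m ih =>
      rw [Finset.sum_range_succ]
      have hp : (0 : ℝ) < 1 + m * h := by positivity
      have hq : (0 : ℝ) < 1 + ((m + 1 : ℕ) : ℝ) * h := by positivity
      have hd : 1 / (1 + m * h) - 1 / (1 + ((m + 1 : ℕ) : ℝ) * h) =
          h / ((1 + m * h) * (1 + ((m + 1 : ℕ) : ℝ) * h)) := by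
        rw [div_sub_div _ _ hp.ne' hq.ne']
        push_cast
        ring
      have hle : h ^ 6 / (1 + ((m + 1 : ℕ) : ℝ) * h) ^ 2 ≤
          h ^ 5 * (1 / (1 + m * h) - 1 / (1 + ((m + 1 : ℕ) : ℝ) * h)) := by
        rw [hd, ← mul_div_assoc, ← pow_succ, sq]
        refine div_le_div_of_nonneg_left (by positivity) (by positivity) ?_
        refine mul_le_mul_of_nonneg_right ?_ hq.le
        push_cast
        linarith
      linarith
  refine key.trans (mul_le_of_le_one_right (by positivity) ?_)
  have : 0 ≤ 1 / (1 + m * h) := by positivity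
  linarith

lemma abs_sum_tailProb_sub_le : ∃ C : ℝ, 0 ≤ C ∧ ∀ n : ℕ, 1 ≤ n →
    |∑ k ∈ Finset.range n, tailProb n (k + 1) -
      ∑ k ∈ Finset.range (2 * n), binomWeight n (k + 1) * correction (k + 1 : ℕ) (1 / n)| ≤
      C * (1 / √n) ^ 5 := by
  obtain ⟨C, hC, h⟩ := abs_tailProb_sub_le
  refine ⟨C, hC, fun n hn => ?_⟩
  -- The tail probabilities vanish from n on, but the binomial weights reach as far as 2n.
  have h1 : ∑ k ∈ Finset.range n, tailProb n (k + 1) =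
      ∑ k ∈ Finset.range (2 * n), tailProb n (k + 1) := by
    refine Finset.sum_subset (Finset.range_mono (by omega)) fun k _ hk => ?_
    exact tailProb_eq_zero (by omega) (by simp at hk; omega)
  rw [h1, ← Finset.sum_sub_distrib]
  refine (Finset.abs_sum_le_sum_abs _ _).trans ?_
  refine (Finset.sum_le_sum fun k _ => h n (k + 1) hn (by omega)).trans ?_
  rw [← Finset.mul_sum]
  refine mul_le_mul_of_nonneg_left (sum_one_div_sq_le ?_ _) hC
  have : (0 : ℝ) < n := by exact_mod_cast hn
  positivity

/-! ### Exact summation against binomial weights -/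

/-- A polynomial whose twisted difference is the correction factor up to a constant. -/
noncomputable def antidiff (k y : ℝ) : ℝ :=
    k ^ 14 * y ^ 9 / 58320 - 7 * k ^ 13 * y ^ 9 / 58320 - 79 * k ^ 12 * y ^ 8 / 233280
    - k ^ 11 * y ^ 7 / 3888 + 79 * k ^ 11 * y ^ 8 / 38880 + 91 * k ^ 11 * y ^ 9 / 58320
    + 4141 * k ^ 10 * y ^ 7 / 1244160 - 91 * k ^ 10 * y ^ 8 / 29160 + 31 * k ^ 9 * y ^ 6 / 15552
    - 2381 * k ^ 9 * y ^ 7 / 248832 - 47 * k ^ 9 * y ^ 8 / 15552 - 1001 * k ^ 9 * y ^ 9 / 58320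
    + k ^ 8 * y ^ 5 / 324 - 18413 * k ^ 8 * y ^ 6 / 2488320 - 71 * k ^ 8 * y ^ 7 / 15552
    + 1001 * k ^ 8 * y ^ 8 / 29160 - 6149 * k ^ 7 * y ^ 5 / 414720 + 9293 * k ^ 7 * y ^ 6 / 622080
    + 4135 * k ^ 7 * y ^ 7 / 124416 - 5647 * k ^ 7 * y ^ 8 / 58320 + 2431 * k ^ 7 * y ^ 9 / 19440
    + k ^ 6 * y ^ 4 / 2592 + 331031 * k ^ 6 * y ^ 5 / 17418240 - 6151 * k ^ 6 * y ^ 6 / 62208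
    + 14759 * k ^ 6 * y ^ 7 / 58320 - 2431 * k ^ 6 * y ^ 8 / 9720 - k ^ 5 * y ^ 3 / 36
    - 2057 * k ^ 5 * y ^ 4 / 138240 + 18643 * k ^ 5 * y ^ 5 / 241920
    + 127609 * k ^ 5 * y ^ 6 / 1244160 - 458771 * k ^ 5 * y ^ 7 / 622080
    + 49183 * k ^ 5 * y ^ 8 / 46656 - 31031 * k ^ 5 * y ^ 9 / 58320 + 629 * k ^ 4 * y ^ 3 / 8640
    + 8083 * k ^ 4 * y ^ 4 / 215040 - 3118037 * k ^ 4 * y ^ 5 / 4976640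
    + 569861 * k ^ 4 * y ^ 6 / 311040 - 106781 * k ^ 4 * y ^ 7 / 46656
    + 31031 * k ^ 4 * y ^ 8 / 29160 - 31 * k ^ 3 * y ^ 2 / 288 - 2111 * k ^ 3 * y ^ 3 / 46080
    + 2106793 * k ^ 3 * y ^ 4 / 5806080 + 49513 * k ^ 3 * y ^ 5 / 362880
    - 1844783 * k ^ 3 * y ^ 6 / 622080 + 1369495 * k ^ 3 * y ^ 7 / 248832
    - 92869 * k ^ 3 * y ^ 8 / 23328 + 62881 * k ^ 3 * y ^ 9 / 58320 + k ^ 2 * y / 6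
    + 1511 * k ^ 2 * y ^ 2 / 8640 - 39101 * k ^ 2 * y ^ 3 / 5806080
    - 26557757 * k ^ 2 * y ^ 4 / 11612160 + 19687651 * k ^ 2 * y ^ 5 / 2488320
    - 1482523 * k ^ 2 * y ^ 6 / 124416 + 190853 * k ^ 2 * y ^ 7 / 23328
    - 62881 * k ^ 2 * y ^ 8 / 29160 - 35 * k * y / 96 - 3191 * k * y ^ 2 / 138240
    + 6795389 * k * y ^ 3 / 5806080 - 2367367 * k * y ^ 4 / 2903040
    - 22891091 * k * y ^ 5 / 4354560 + 30531487 * k * y ^ 6 / 2488320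
    - 1499239 * k * y ^ 7 / 138240 + 112393 * k * y ^ 8 / 25920 - 38227 * k * y ^ 9 / 58320
    + 7 / 12 + 727 * y / 8640 - 120013 * y ^ 2 / 5806080 - 23158799 * y ^ 3 / 5806080
    + 1080334027 * y ^ 4 / 69672960 - 52835243 * y ^ 5 / 1990656 + 4577147 * y ^ 6 / 207360
    - 677813 * y ^ 7 / 77760 + 38227 * y ^ 8 / 29160

/-- The constant to which `correction k y` reduces modulo twisted differences. -/
noncomputable def gaussCoeff (y : ℝ) : ℝ :=
    1 + 19 * y / 48 - 407 * y ^ 2 / 4608 - 10717 * y ^ 3 / 4608 + 300433 * y ^ 4 / 55296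
    - 3731573 * y ^ 5 / 829440 + 7943 * y ^ 6 / 5184 - 691 * y ^ 7 / 3888

/-- A summation certificate. With y = 1/n and w the binomial weights, w(k+1)(2+y(k+1)) = w(k)(2-yk),
so w(k) times the bracket is the increment of w(k)·`antidiff k y`·(2+yk). -/
lemma correction_eq (k y : ℝ) : correction k y =
    gaussCoeff y + (antidiff (k + 1) y * (2 - y * k) - antidiff k y * (2 + y * k)) := by
  unfold correction expPoly gaussCoeff antidiff logTerm₁ logTerm₂ logTerm₃ logTerm₄ logTerm₅
  simp only [Finset.sum_range_succ, Finset.sum_range_zero, expCoeff]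
  ring

lemma correction_zero (y : ℝ) : correction 0 y = 1 := by
  simp [correction, expPoly, Finset.sum_range_succ, expCoeff, logTerm₁, logTerm₂, logTerm₃,
    logTerm₄, logTerm₅]

/-- The reciprocal of the central binomial probability of `4 n` fair coin tosses. -/
noncomputable def centralRatio (n : ℕ) : ℝ := 4 ^ (2 * n) / ((2 * n).centralBinom : ℝ)

/-- By symmetry, twice the half-row including the centre is the full row plus the central
coefficient. -/
lemma sum_binomWeight (n : ℕ) :
    ∑ k ∈ Finset.range (2 * n + 1), binomWeight n k = (centralRatio n + 1) / 2 := by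
  have hc : ((4 * n).choose (2 * n) : ℝ) ≠ 0 := by exact_mod_cast (Nat.choose_pos (by omega)).ne'
  have h1 : ∑ k ∈ Finset.range (2 * n + 1), (4 * n).choose (2 * n + k) =
      ∑ k ∈ Finset.range (2 * n + 1), (4 * n).choose k := by
    rw [← Finset.sum_range_reflect]
    refine Finset.sum_congr rfl fun k hk => ?_
    have hk := Finset.mem_range.1 hk
    rw [← Nat.choose_symm (by omega)]
    congr 1
    omega
  have h2 := Nat.sum_range_choose (4 * n)
  have h3 : 4 * n + 1 = 2 * n + (2 * n + 1) := by ring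
  rw [h3, Finset.sum_range_add, h1, Finset.sum_range_succ] at h2
  have h4 : 2 * (∑ k ∈ Finset.range (2 * n + 1), (4 * n).choose (2 * n + k)) =
      2 ^ (4 * n) + (4 * n).choose (2 * n) := by
    rw [h1, Finset.sum_range_succ]
    omega
  have h5 : (2 : ℝ) * ∑ k ∈ Finset.range (2 * n + 1), ((4 * n).choose (2 * n + k) : ℝ) =
      2 ^ (4 * n) + (4 * n).choose (2 * n) := by exact_mod_cast h4
  have h6 : ((2 * n).centralBinom : ℝ) = (4 * n).choose (2 * n) := by
    rw [Nat.centralBinom]; congr 2; ring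
  have h7 : (4 : ℝ) ^ (2 * n) = 2 ^ (4 * n) := by
    rw [show (4 : ℝ) = 2 ^ 2 by norm_num, ← pow_mul]; congr 1; ring
  simp only [binomWeight]
  rw [← Finset.sum_div, centralRatio, h6, h7]
  field_simp
  linarith

/-- The upper boundary term vanishes with the weight at 2n + 1, the lower one is 2·`antidiff 0`, and
the final -1 removes the term k = 0. -/
lemma sum_binomWeight_mul_correction {n : ℕ} (hn : 1 ≤ n) :
    ∑ k ∈ Finset.range (2 * n), binomWeight n (k + 1) * correction (k + 1 : ℕ) (1 / n) =
      gaussCoeff (1 / n) * ((centralRatio n + 1) / 2) - 2 * antidiff 0 (1 / n) - 1 := by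
  have hn' : (n : ℝ) ≠ 0 := by have : (0 : ℝ) < n := by exact_mod_cast hn
                               exact this.ne'
  set y : ℝ := 1 / n with hy
  have hyn : y * n = 1 := by rw [hy]; field_simp
  have h1 : ∑ k ∈ Finset.range (2 * n + 1), binomWeight n k * correction k y =
      gaussCoeff y * ((centralRatio n + 1) / 2) - 2 * antidiff 0 y := by
    have tele : ∀ k : ℕ, binomWeight n k * correction k y = gaussCoeff y * binomWeight n k +
        (binomWeight n (k + 1) * antidiff (k + 1 : ℕ) y * (2 + y * (k + 1 : ℕ)) -
          binomWeight n k * antidiff k y * (2 + y * k)) := by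
      intro k
      have e := binomWeight_succ n k
      have e' : binomWeight n (k + 1) * (2 + y * (k + 1)) = binomWeight n k * (2 - y * k) := by
        linear_combination y * e + (2 * binomWeight n k - 2 * binomWeight n (k + 1)) * hyn
      rw [correction_eq]
      push_cast
      linear_combination -antidiff (k + 1) y * e'
    rw [Finset.sum_congr rfl fun k _ => tele k, Finset.sum_add_distrib, ← Finset.mul_sum,
      sum_binomWeight, Finset.sum_range_sub fun k => binomWeight n k * antidiff k y * (2 + y * k),
      binomWeight_eq_zero (by omega), binomWeight_zero]
    push_cast
    ring
  rw [Finset.sum_range_succ', binomWeight_zero, Nat.cast_zero, correction_zero] at h1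
  linarith

/-! ### Asymptotics of the central binomial coefficient -/

section CentralBinom

open Real

/-- The logarithmic error of the approximation `√(π m)` to `4 ^ m / centralBinom m`. -/
noncomputable def logWallis (m : ℕ) : ℝ := log (4 ^ m / (m.centralBinom : ℝ) / √(π * m))

/-- The argument of the logarithm equals the square of the Stirling sequence at m, divided by its
value at 2m and by √π. -/
lemma tendsto_logWallis : Tendsto logWallis atTop (nhds 0) := by
  have h1 := Stirling.tendsto_stirlingSeq_sqrt_pi
  have h2 : Tendsto (fun m : ℕ => Stirling.stirlingSeq (2 * m)) atTop (nhds √π) :=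
    h1.comp (tendsto_id.const_mul_atTop' (by norm_num))
  have hpi : √π ≠ 0 := (sqrt_pos.2 pi_pos).ne'
  have h3 := ((h1.pow 2).div h2 hpi).div_const √π
  have h4 : √π ^ 2 / √π / √π = 1 := by field_simp
  rw [h4] at h3
  have h5 := (continuousAt_log one_ne_zero).tendsto.comp h3
  rw [log_one] at h5
  refine h5.congr' ?_
  filter_upwards [eventually_ge_atTop 1] with m hm
  have hm' : (0 : ℝ) < m := by exact_mod_cast hm
  simp only [Function.comp_apply, logWallis, Pi.div_apply]
  congr 1
  have hcb : (m.centralBinom : ℝ) = (2 * m).factorial / (m.factorial * m.factorial) := by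
    have := Nat.centralBinom_eq_two_mul_choose m
    rw [this, Nat.cast_choose ℝ (by omega)]
    congr 3
    · congr 1; omega
  have hs : √(2 * ((2 * m : ℕ) : ℝ)) = 2 * √m := by
    push_cast
    rw [show (2 : ℝ) * (2 * m) = 2 ^ 2 * m by ring, sqrt_mul (by norm_num), sqrt_sq (by norm_num)]
  have hs2 : √(2 * (m : ℝ)) ^ 2 = 2 * m := sq_sqrt (by positivity)
  have hs3 : √(m : ℝ) ^ 2 = m := sq_sqrt hm'.le
  have hp4 : (2 * (m : ℝ) / exp 1) ^ (2 * m) = 4 ^ m * ((m : ℝ) / exp 1) ^ m * (m / exp 1) ^ m := by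
    rw [mul_div_assoc, mul_pow, pow_mul, two_mul m, pow_add]; norm_num; ring
  rw [hcb, Stirling.stirlingSeq, Stirling.stirlingSeq, hs, sqrt_mul pi_pos.le]
  push_cast
  rw [hp4, div_pow, mul_pow, hs2]
  have e0 : ((m : ℝ) / exp 1) ^ m ≠ 0 := by positivity
  have e1 : √(m : ℝ) ≠ 0 := by positivity
  generalize ((m : ℝ) / exp 1) ^ m = E at *
  field_simp
  rw [hs3]

lemma logWallis_succ_sub {m : ℕ} (hm : 1 ≤ m) :
    logWallis (m + 1) - logWallis m = log (1 - 1 / (2 * (m : ℝ) + 1) ^ 2) / 2 := by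
  have hm' : (0 : ℝ) < m := by exact_mod_cast hm
  have hc : (0 : ℝ) < m.centralBinom := by exact_mod_cast Nat.centralBinom_pos m
  have hc' : (0 : ℝ) < (m + 1).centralBinom := by exact_mod_cast Nat.centralBinom_pos (m + 1)
  have h1 : ((m : ℝ) + 1) * (m + 1).centralBinom = 2 * (2 * m + 1) * m.centralBinom := by
    exact_mod_cast Nat.succ_mul_centralBinom_succ m
  have h2 : ((m + 1).centralBinom : ℝ) = 2 * (2 * m + 1) * m.centralBinom / (m + 1) := by
    field_simp; linarith
  have hp := pi_pos
  rw [logWallis, logWallis, ← log_div (by positivity) (by positivity), ← log_sqrt]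
  · congr 1
    rw [h2]
    have e1 : (1 : ℝ) - 1 / (2 * m + 1) ^ 2 = 4 * (m * (m + 1)) / (2 * m + 1) ^ 2 := by
      field_simp; ring
    have e4 : √(π * (m + 1 : ℕ)) ^ 2 = π * (m + 1 : ℕ) := sq_sqrt (by positivity)
    have e4' : √(π * m) ^ 2 = π * m := sq_sqrt (by positivity)
    have e5 : 0 < √(π * (m + 1 : ℕ)) := by positivity
    have e6 : 0 < √(π * m) := by positivity
    have e7 : 4 * ((m : ℝ) * (m + 1)) / (2 * m + 1) ^ 2 =
        (2 * √(π * m) * √(π * (m + 1 : ℕ)) / (π * (2 * m + 1))) ^ 2 := by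
      rw [div_pow, mul_pow, mul_pow, e4, e4']
      push_cast
      field_simp
      ring
    rw [e1, e7, sqrt_sq (by positivity), pow_succ]
    push_cast at *
    generalize √(π * ((m : ℝ) + 1)) = r at *
    generalize √(π * (m : ℝ)) = q at *
    field_simp
    rw [e4]
    ring
  · have : (1 : ℝ) / (2 * m + 1) ^ 2 ≤ 1 := by
      rw [div_le_one (by positivity)]; nlinarith
    linarith

/-- Since 1/(8j) telescopes with increments z/(2(1-z)), z = 1/(2j+1)², the bounds -z/(1-z) ≤
log(1-z) ≤ -z make `logWallis j - 1/(8j)` increasing and its sum with 1/j³ decreasing. Both tend to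
0, which traps the value at m. -/
lemma abs_logWallis_sub_le {m : ℕ} (hm : 1 ≤ m) :
    |logWallis m - 1 / (8 * m)| ≤ 1 / (m : ℝ) ^ 3 := by
  have hstep : ∀ j : ℕ, 1 ≤ j →
      0 ≤ (logWallis (j + 1) - 1 / (8 * (j + 1 : ℕ))) - (logWallis j - 1 / (8 * j)) ∧
      (logWallis (j + 1) - 1 / (8 * (j + 1 : ℕ))) - (logWallis j - 1 / (8 * j)) ≤
        1 / (j : ℝ) ^ 3 - 1 / ((j + 1 : ℕ) : ℝ) ^ 3 := by
    intro j hj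
    have hj' : (1 : ℝ) ≤ j := by exact_mod_cast hj
    have hj0 : (0 : ℝ) < j := by linarith
    set z : ℝ := 1 / (2 * j + 1) ^ 2 with hz
    have hz0 : 0 < z := by positivity
    have hz1 : 1 - z = 4 * j * (j + 1) / (2 * j + 1) ^ 2 := by rw [hz]; field_simp; ring
    have hzp : 0 < 1 - z := by rw [hz1]; positivity
    have hdiff : (1 : ℝ) / (8 * j) - 1 / (8 * (j + 1 : ℕ)) = z / (1 - z) / 2 := by
      rw [hz1, hz]; push_cast; field_simp; ring
    have hl1 : log (1 - z) ≤ -z := by have := log_le_sub_one_of_pos hzp; linarith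
    have hl2 : -(z / (1 - z)) ≤ log (1 - z) := by
      have := one_sub_inv_le_log_of_pos hzp
      have e : 1 - (1 - z)⁻¹ = -(z / (1 - z)) := by field_simp; ring
      linarith
    have hs := logWallis_succ_sub hj
    rw [← hz] at hs
    refine ⟨by linarith, ?_⟩
    have hub : (z / (1 - z) - z) / 2 ≤ 1 / (j : ℝ) ^ 3 - 1 / ((j + 1 : ℕ) : ℝ) ^ 3 := by
      have e1 : (z / (1 - z) - z) / 2 = 1 / (8 * j * (j + 1) * (2 * j + 1) ^ 2) := by
        rw [hz1, hz]; field_simp; ring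
      have e2 : 1 / (j : ℝ) ^ 3 - 1 / ((j + 1 : ℕ) : ℝ) ^ 3 =
          (3 * j ^ 2 + 3 * j + 1) / (j ^ 3 * (j + 1) ^ 3) := by
        push_cast; field_simp; ring
      rw [e1, e2, div_le_div_iff₀ (by positivity) (by positivity), one_mul]
      have e3 : (j : ℝ) ^ 3 * (j + 1) ^ 3 = (j * (j + 1)) * (j * (j + 1)) ^ 2 := by ring
      have e4 : (3 * (j : ℝ) ^ 2 + 3 * j + 1) * (8 * j * (j + 1) * (2 * j + 1) ^ 2) =
          (j * (j + 1)) * ((3 * (j : ℝ) ^ 2 + 3 * j + 1) * 8 * (2 * j + 1) ^ 2) := by ring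
      rw [e3, e4]
      refine mul_le_mul_of_nonneg_left ?_ (by positivity)
      have : 0 < (j : ℝ) ^ 2 := by positivity
      have : 0 < (j : ℝ) ^ 3 := by positivity
      have : 0 < (j : ℝ) ^ 4 := by positivity
      nlinarith
    linarith
  have hlim0 : Tendsto (fun j : ℕ => (1 : ℝ) / (8 * j)) atTop (nhds 0) := by
    have := tendsto_one_div_atTop_nhds_zero_nat (𝕜 := ℝ)
    have h2 := this.const_mul (1 / 8 : ℝ)
    rw [mul_zero] at h2
    refine h2.congr fun j => ?_
    rw [one_div_mul_one_div]
  have hlim : Tendsto (fun j : ℕ => logWallis j - 1 / (8 * j)) atTop (nhds 0) := by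
    simpa using tendsto_logWallis.sub hlim0
  have hlim3 : Tendsto (fun j : ℕ => (logWallis j - 1 / (8 * j)) + 1 / (j : ℝ) ^ 3) atTop
      (nhds 0) := by
    have := (tendsto_one_div_atTop_nhds_zero_nat (𝕜 := ℝ)).pow 3
    simpa using hlim.add this
  have hmono : ∀ j, m ≤ j → logWallis m - 1 / (8 * m) ≤ logWallis j - 1 / (8 * j) := by
    intro j hj
    induction j, hj using Nat.le_induction with
    | base => exact le_rfl
    | succ j hj ih => have := (hstep j (by omega)).1; linarith
  have hanti : ∀ j, m ≤ j → (logWallis j - 1 / (8 * j)) + 1 / (j : ℝ) ^ 3 ≤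
      (logWallis m - 1 / (8 * m)) + 1 / (m : ℝ) ^ 3 := by
    intro j hj
    induction j, hj using Nat.le_induction with
    | base => exact le_rfl
    | succ j hj ih => have := (hstep j (by omega)).2; linarith
  have h1 := ge_of_tendsto hlim ((eventually_ge_atTop m).mono hmono)
  have h2 := le_of_tendsto hlim3 ((eventually_ge_atTop m).mono hanti)
  rw [abs_le]
  have : 0 ≤ 1 / (m : ℝ) ^ 3 := by positivity
  constructor <;> linarith

/-- At m = 2n the logarithmic error is y/16 + O(y³) with y = 1/n, and exp(y/16) = 1 + y/16 + y²/512
+ O(y³). -/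
lemma abs_centralRatio_sub_le : ∃ C : ℝ, 0 ≤ C ∧ ∀ n : ℕ, 1 ≤ n →
    |centralRatio n - √(2 * π * n) * (1 + (1 / n) / 16 + (1 / n) ^ 2 / 512)| ≤
      C * √n * (1 / n) ^ 3 := by
  refine ⟨√(2 * π), by positivity, fun n hn => ?_⟩
  have hn' : (1 : ℝ) ≤ n := by exact_mod_cast hn
  have hn0 : (0 : ℝ) < n := by linarith
  have hw := abs_logWallis_sub_le (m := 2 * n) (by omega)
  have hp := pi_pos
  have hc : (0 : ℝ) < (2 * n).centralBinom := by exact_mod_cast Nat.centralBinom_pos (2 * n)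
  have hB : centralRatio n = √(2 * π * n) * exp (logWallis (2 * n)) := by
    rw [logWallis, exp_log (by positivity), centralRatio]
    have : √(π * (2 * n : ℕ)) = √(2 * π * n) := by push_cast; congr 1; ring
    rw [this]
    field_simp
  set w := logWallis (2 * n)
  set y : ℝ := 1 / n with hy
  have hy0 : 0 < y := by positivity
  have hy1 : y ≤ 1 := by rw [hy, div_le_one hn0]; exact hn'
  have e1 : (1 : ℝ) / (8 * (2 * n : ℕ)) = y / 16 := by rw [hy]; push_cast; field_simp; norm_num
  have e2 : (1 : ℝ) / ((2 * n : ℕ) : ℝ) ^ 3 = y ^ 3 / 8 := by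
    rw [hy]; push_cast; field_simp; norm_num
  rw [e1, e2, abs_le] at hw
  have hy3 : y ^ 3 ≤ y := by
    have := pow_le_pow_of_le_one hy0.le hy1 (show 1 ≤ 3 by norm_num)
    simpa using this
  have hw1 : |w| ≤ y / 4 := by rw [abs_le]; constructor <;> linarith
  have hexp := Real.exp_bound (x := w) (by linarith) (n := 3) (by norm_num)
  have hw3 : |w| ^ 3 ≤ (y / 4) ^ 3 := pow_le_pow_left₀ (abs_nonneg _) hw1 3
  simp only [Finset.sum_range_succ, Finset.sum_range_zero] at hexp
  norm_num [Nat.factorial] at hexp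
  have hsq : |w ^ 2 - (y / 16) ^ 2| ≤ y ^ 3 / 8 := by
    have : w ^ 2 - (y / 16) ^ 2 = (w - y / 16) * (w + y / 16) := by ring
    rw [this]
    have a1 : |w - y / 16| ≤ y ^ 3 / 8 := by rw [abs_le]; constructor <;> linarith
    have a2 : |w + y / 16| ≤ 1 := by
      have := abs_le.1 hw1
      rw [abs_le]; constructor <;> linarith
    simpa using abs_mul_le_of_le a1 a2
  have hE : |exp w - (1 + y / 16 + y ^ 2 / 512)| ≤ y ^ 3 := by
    have b1 := abs_le.1 hexp
    have b2 := abs_le.1 hsq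
    have : 0 < y ^ 3 := by positivity
    rw [abs_le]
    constructor <;> nlinarith
  rw [hB, ← mul_sub, abs_mul, abs_of_nonneg (sqrt_nonneg _), sqrt_mul (by positivity)]
  exact mul_le_mul_of_nonneg_left hE (by positivity)

end CentralBinom

/-! ### Assembling the expansion of the expectation -/

lemma exists_abs_le_of_continuous {P : ℝ → ℝ} (hP : Continuous P) :
    ∃ C : ℝ, 0 ≤ C ∧ ∀ y : ℝ, 0 ≤ y → y ≤ 1 → |P y| ≤ C := by
  obtain ⟨C, hC⟩ := isCompact_Icc.exists_bound_of_continuousOn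
    (s := Set.Icc (0 : ℝ) 1) hP.continuousOn
  exact ⟨|C|, abs_nonneg C, fun y h0 h1 => (hC y ⟨h0, h1⟩).trans (le_abs_self C)⟩

lemma continuous_gaussCoeff : Continuous gaussCoeff := by
  unfold gaussCoeff; fun_prop

lemma gaussCoeff_mul_expansion : ∃ C : ℝ, 0 ≤ C ∧ ∀ y : ℝ, 0 ≤ y → y ≤ 1 →
    |gaussCoeff y * (1 + y / 16 + y ^ 2 / 512) - (1 + 11 / 24 * y - 71 / 1152 * y ^ 2)| ≤
      C * y ^ 3 := by
  obtain ⟨C, hC, h⟩ := exists_abs_le_of_continuous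
    (P := fun y => -28637 / 12288 + 37425371 / 7077888 * y - 442071649 / 106168320 * y ^ 2
      + 178595573 / 141557760 * y ^ 3 - 115617119 / 1274019840 * y ^ 4
      - 64619 / 7962624 * y ^ 5 - 691 / 1990656 * y ^ 6) (by fun_prop)
  refine ⟨C, hC, fun y h0 h1 => ?_⟩
  refine le_trans (le_of_eq ?_) (mul_le_mul_of_nonneg_right (h y h0 h1) (pow_nonneg h0 3))
  rw [← abs_of_nonneg (pow_nonneg h0 3), ← abs_mul, abs_of_nonneg (pow_nonneg h0 3)]
  congr 1
  unfold gaussCoeff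
  ring

/-- Collects everything free of π: half of the constant from the central term, the boundary value
and the removed term k = 0. Its y² coefficient is the first one missing from `expansion`. -/
lemma rational_part_expansion : ∃ C : ℝ, 0 ≤ C ∧ ∀ y : ℝ, 0 ≤ y → y ≤ 1 →
    |gaussCoeff y / 2 - 2 * antidiff 0 y - 1 - (-5 / 3 + 4 / 135 * y - 8 / 2835 * y ^ 2)| ≤
      C * y ^ 3 := by
  obtain ⟨C, hC, h⟩ := exists_abs_le_of_continuous
    (P := fun y => 618217 / 90720 - 30803051 / 1088640 * y + 31622687 / 622080 * y ^ 2
      - 1499239 / 34560 * y ^ 3 + 112393 / 6480 * y ^ 4 - 38227 / 14580 * y ^ 5) (by fun_prop)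
  refine ⟨C, hC, fun y h0 h1 => ?_⟩
  refine le_trans (le_of_eq ?_) (mul_le_mul_of_nonneg_right (h y h0 h1) (pow_nonneg h0 3))
  rw [← abs_of_nonneg (pow_nonneg h0 3), ← abs_mul, abs_of_nonneg (pow_nonneg h0 3)]
  congr 1
  unfold gaussCoeff antidiff
  ring

/-- The next term of the asymptotic expansion: the expectation differs from `expansion n` by
`-8 / 2835 * n ^ (-5 / 2)` up to `O(n⁻³)`. -/
lemma abs_expectation_sub_expansion_le : ∃ C : ℝ, ∀ n : ℕ, 1 ≤ n →
    |(∑ k ∈ Finset.range n, tailProb n (k + 1)) / √(n : ℝ) - expansion n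
      - (-8 / 2835) * (1 / √(n : ℝ)) ^ 5| ≤ C * (1 / √(n : ℝ)) ^ 6 := by
  obtain ⟨C₁, hC₁, h₁⟩ := abs_sum_tailProb_sub_le
  obtain ⟨C₂, hC₂, h₂⟩ := abs_centralRatio_sub_le
  obtain ⟨C₃, hC₃, h₃⟩ := gaussCoeff_mul_expansion
  obtain ⟨C₄, hC₄, h₄⟩ := rational_part_expansion
  obtain ⟨C₅, hC₅, h₅⟩ := exists_abs_le_of_continuous continuous_gaussCoeff
  set q : ℝ := √(Real.pi / 2) with hq
  refine ⟨C₁ + C₅ * C₂ + q * C₃ + C₄, fun n hn => ?_⟩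
  have hn' : (1 : ℝ) ≤ n := by exact_mod_cast hn
  have hr1 : 1 ≤ √(n : ℝ) := Real.one_le_sqrt.2 hn'
  have hr2 : √(n : ℝ) ^ 2 = n := Real.sq_sqrt (by linarith)
  have hsq : √(2 * Real.pi * n) = 2 * q * √(n : ℝ) := by
    rw [show 2 * Real.pi * (n : ℝ) = 2 ^ 2 * (Real.pi / 2) * n by ring,
      Real.sqrt_mul (by positivity), Real.sqrt_mul (by norm_num), Real.sqrt_sq (by norm_num)]
  have e₁ := h₁ n hn
  rw [sum_binomWeight_mul_correction hn] at e₁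
  have e₂ := h₂ n hn
  rw [hsq] at e₂
  have hexpand : expansion n = q * (1 + 11 / 24 * (1 / n) - 71 / 1152 * (1 / n) ^ 2)
      + 1 / √(n : ℝ) * (-5 / 3 + 4 / 135 * (1 / n)) := by
    rw [expansion, ← hq]
    have : (n : ℝ) ≠ 0 := by linarith
    field_simp
    ring
  set r := √(n : ℝ) with hr
  have hr0 : 0 < r := by linarith
  set h : ℝ := 1 / r with hh
  have hrh : r * h = 1 := by rw [hh]; field_simp
  have hh0 : 0 < h := by positivity
  have hh1 : h ≤ 1 := by rw [hh, div_le_one hr0]; exact hr1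
  have hy : (1 : ℝ) / n = h ^ 2 := by rw [hh, div_pow, hr2, one_pow]
  rw [hexpand, div_eq_mul_one_div, ← hh]
  rw [hy] at e₁ e₂ ⊢
  have hy0 : 0 ≤ h ^ 2 := by positivity
  have hy1 : h ^ 2 ≤ 1 := pow_le_one₀ hh0.le hh1
  have e₃ := h₃ _ hy0 hy1
  have e₄ := h₄ _ hy0 hy1
  have e₅ := h₅ _ hy0 hy1
  set α := gaussCoeff (h ^ 2)
  set G := antidiff 0 (h ^ 2)
  set S := ∑ k ∈ Finset.range n, tailProb n (k + 1)
  set B := centralRatio n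
  have f₁ := abs_mul_le_of_le (abs_of_pos hh0).le e₁
  have f₂ := abs_mul_le_of_le (abs_of_pos hh0).le (abs_mul_le_of_le e₅ e₂)
  have f₃ := abs_mul_le_of_le (abs_of_nonneg (Real.sqrt_nonneg (Real.pi / 2))).le e₃
  have f₄ := abs_mul_le_of_le (abs_of_pos hh0).le e₄
  rw [← hq] at f₃
  -- The four summands are the errors from the binomial replacement, the central binomial
  -- coefficient, the terms with √(π/2), and the rational terms.
  have key : S * h - (q * (1 + 11 / 24 * h ^ 2 - 71 / 1152 * (h ^ 2) ^ 2)
      + h * (-5 / 3 + 4 / 135 * h ^ 2)) - (-8 / 2835) * h ^ 5 =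
      h * (S - (α * ((B + 1) / 2) - 2 * G - 1))
      + h * (α * (B - 2 * q * r * (1 + h ^ 2 / 16 + (h ^ 2) ^ 2 / 512))) / 2
      + q * (α * (1 + h ^ 2 / 16 + (h ^ 2) ^ 2 / 512)
        - (1 + 11 / 24 * h ^ 2 - 71 / 1152 * (h ^ 2) ^ 2))
      + h * (α / 2 - 2 * G - 1 - (-5 / 3 + 4 / 135 * h ^ 2 - 8 / 2835 * (h ^ 2) ^ 2)) := by
    linear_combination (α * q * (1 + h ^ 2 / 16 + (h ^ 2) ^ 2 / 512)) * hrh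
  rw [key]
  have g₁ : h * (C₁ * h ^ 5) = C₁ * h ^ 6 := by ring
  have g₂ : h * (C₅ * (C₂ * r * (h ^ 2) ^ 3)) = C₅ * C₂ * h ^ 6 := by
    linear_combination (C₅ * C₂ * h ^ 6) * hrh
  have g₃ : q * (C₃ * (h ^ 2) ^ 3) = q * C₃ * h ^ 6 := by ring
  have g₄ : h * (C₄ * (h ^ 2) ^ 3) ≤ C₄ * h ^ 6 := by
    have : h * (C₄ * (h ^ 2) ^ 3) = h * (C₄ * h ^ 6) := by ring
    rw [this]
    exact mul_le_of_le_one_left (by positivity) hh1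
  have g₅ : 0 ≤ C₅ * C₂ * h ^ 6 := by positivity
  rw [g₁] at f₁
  rw [g₂] at f₂
  rw [g₃] at f₃
  have f₄ := f₄.trans g₄
  rw [abs_le] at *
  constructor <;> linarith

end BubbleSort

/-! ### The exact order of the error -/

theorem mainTheorem4
    {α : Type*} [LinearOrder α]
    (x : (n : ℕ) → Fin n → α) (hx : ∀ n, Function.Injective (x n))
    {Ω : ℕ → Type*} [∀ n, MeasurableSpace (Ω n)]
    (μ : (n : ℕ) → Measure (Ω n)) [∀ n, IsProbabilityMeasure (μ n)]
    (σ : (n : ℕ) → Ω n → Equiv.Perm (Fin n))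
    (hσ : ∀ n, BubbleSort.IsUniformPerm (μ n) (σ n)) :
    (fun n : ℕ =>
        (∫ ω, BubbleSort.normalizedPasses (fun k : Fin n => x n (σ n ω k)) ∂(μ n))
          - BubbleSort.expansion n)
      =Θ[atTop] (fun n : ℕ => 1 / ((n : ℝ) ^ 2 * √(n : ℝ))) := by
  set f : ℕ → ℝ := fun n =>
    (∫ ω, BubbleSort.normalizedPasses (fun k : Fin n => x n (σ n ω k)) ∂(μ n))
      - BubbleSort.expansion n with hf
  set g : ℕ → ℝ := fun n => 1 / ((n : ℝ) ^ 2 * √(n : ℝ)) with hg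
  have hg5 : ∀ n, g n = (1 / √(n : ℝ)) ^ 5 := by
    intro n
    have : (n : ℝ) ^ 2 * √(n : ℝ) = √(n : ℝ) ^ 5 := by
      rw [show √(n : ℝ) ^ 5 = (√(n : ℝ) ^ 2) ^ 2 * √(n : ℝ) by ring,
        Real.sq_sqrt (Nat.cast_nonneg n)]
    rw [hg]
    simp only
    rw [this, div_pow, one_pow]
  have hlim : Tendsto (fun n : ℕ => 1 / √(n : ℝ)) atTop (nhds 0) := by
    simp only [one_div]
    exact tendsto_inv_atTop_zero.comp (Real.tendsto_sqrt_atTop.comp tendsto_natCast_atTop_atTop)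
  have hsmall : (fun n : ℕ => (1 / √(n : ℝ)) ^ 6) =o[atTop] g := by
    have h1 : (fun n : ℕ => 1 / √(n : ℝ)) =o[atTop] fun _ => (1 : ℝ) :=
      (isLittleO_one_iff ℝ).2 hlim
    refine (h1.mul_isBigO (isBigO_refl g atTop)).congr (fun n => ?_) fun n => one_mul _
    rw [hg5]; ring
  obtain ⟨C, hC⟩ := BubbleSort.abs_expectation_sub_expansion_le
  -- The difference is asymptotically equivalent to -8/2835 times the comparison function, so the
  -- nonvanishing of this coefficient gives both bounds.
  have hdiff : (fun n => f n - (-8 / 2835) * g n) =o[atTop] fun n => (-8 / 2835 : ℝ) * g n := by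
    refine IsLittleO.const_mul_right (by norm_num) (IsBigO.trans_isLittleO ?_ hsmall)
    refine IsBigO.of_bound C ?_
    filter_upwards [eventually_ge_atTop 1] with n hn
    rw [hf, hg5]
    simp only
    rw [BubbleSort.integral_normalizedPasses (hx n) hn (hσ n), Real.norm_eq_abs,
      Real.norm_of_nonneg (by positivity)]
    exact hC n hn
  have h1 := hdiff.right_isTheta_add.symm
  have h2 : ((fun n => f n - (-8 / 2835) * g n) + fun n => (-8 / 2835 : ℝ) * g n) = f := by
    funext n; simp
  rw [h2] at h1
  exact h1.trans ((isTheta_refl g atTop).const_mul_left (by norm_num))
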